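/- Let $p\ge 3$ be a prime and let $\overline{\mathbb Q}_p$ be an algebraic closure of $\mathbb Q_p$, with the absolute value $|\cdot|=p^{-v_p(\cdot)}$ and valuation $v_p$ normalized by $v_p(p)=1$. Fix a system $(\zeta_{p^m})_{m\ge 0}$ of primitive $p^m$-th roots of unity in $\overline{\mathbb Q}_p$ with $\zeta_{p^{m+1}}^p=\zeta_{p^m}$, a $p$-th root $p^{1/p}$ of $p$, a primitive $2(p-1)$-th root of unity $\zeta_{2(p-1)}$, and a $(p-1)$-th root $p^{1/(p(p-1))}$ of $p^{1/p}$, these choices being normalized by $$\left|\zeta_{p^2}-1-\zeta_{2(p-1)}\,p^{\frac1{p(p-1)}}\right|<\left|\zeta_{p^2}-1\right|.$$ For $m\ge 2$ put $\mathbb K_p^{m,1}=\mathbb Q_p(\zeta_{p^m},p^{1/p})$. With $[\cdot]$ the Teichmüller character, $H_k=\sum_{i=1}^k \frac1i$, and $p^{\frac{k}{p(p-1)}}=\bigl(p^{\frac{1}{p(p-1)}}\bigr)^k$, set $$\pi_p^{2,1}=p^{-1/p}\left(\zeta_{p^2}-\sum_{k=0}^{p-1}\frac1{[k!]}\,\zeta_{2(p-1)}^k\,p^{\frac{k}{p(p-1)}}\right),$$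 $$\mathcal R_p^{3,1}(T)=\sum_{k=0}^{p-1}\frac{(-1)^k}{k!}T^k+\sum_{k=1}^{p-1}\frac{(-1)^k(k-H_k)}{k!}T^{p+k},$$ $$\mathcal R_p^{\ge 4,1}(T)=\sum_{k=0}^{p-1}\frac{(-1)^k}{k!}T^k+\sum_{k=1}^{p-1}\frac{(-1)^k(2k-H_k)}{k!}T^{p+k},$$ $$\pi_p^{3,1}=(\zeta_{p^3}-1)^{-2p+2}\left(\zeta_{p^3}-\mathcal R_p^{3,1}(\pi_p^{2,1})\right),$$ and recursively, for $m\ge 4$, $$\pi_p^{m,1}=(\zeta_{p^m}-1)^{-2p+2}\left(\zeta_{p^m}-\mathcal R_p^{\ge 4,1}(\pi_p^{m-1,1})\right).$$ Then $\mathcal R_p^{3,1}$ and $\mathcal R_p^{\ge 4,1}$ have coefficients in $\mathbb Z_{(p)}$, and for every $m\ge 3$ the element $\pi_p^{m,1}$ belongs to $\mathbb K_p^{m,1}$ and is a uniformizer of $\mathbb K_p^{m,1}$ (a generator of the maximal ideal of its valuation ring), with $$v_p(\pi_p^{m,1})=\frac{1}{p^m(p-1)}.$$ -/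

import Mathlib

open Polynomial
open scoped NNReal Nat

noncomputable section

namespace FalseTate

/-- The valuation ring of an intermediate field `F` of `PadicAlgCl p` over `ℚ_[p]`: the elements
of `F` of `p`-adic absolute value at most `1`. -/
def valuationRing (p : ℕ) [Fact p.Prime] (F : IntermediateField ℚ_[p] (PadicAlgCl p)) :
    ValuationSubring F :=
  (Valued.v : Valuation (PadicAlgCl p) ℝ≥0).valuationSubring.comap (algebraMap F (PadicAlgCl p))

/-- `x` is a uniformizer of `F`: it lies in the valuation ring of `F` and generates its maximal
ideal. -/
def IsUniformizer (p : ℕ) [Fact p.Prime] (F : IntermediateField ℚ_[p] (PadicAlgCl p))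
    (x : PadicAlgCl p) : Prop :=
  ∃ ϖ : valuationRing p F, ((ϖ : F) : PadicAlgCl p) = x ∧
    IsLocalRing.maximalIdeal (valuationRing p F) = Ideal.span {ϖ}

/-- The field `ℚ_p(z, ρ)`; for `z` a primitive `p ^ m`-th root of unity and `ρ` a `p`-th root of
`p` this is the field `ℚ_p(ζ_{p^m}, p^{1/p})`. -/
def field (p : ℕ) [Fact p.Prime] (z ρ : PadicAlgCl p) :
    IntermediateField ℚ_[p] (PadicAlgCl p) :=
  IntermediateField.adjoin ℚ_[p] {z, ρ}

/-- The Teichmüller representative `[a]` in `W(𝔽_p) = ℤ_p` of the class of `a` modulo `p`, viewed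
in `PadicAlgCl p`. -/
def teich (p : ℕ) [Fact p.Prime] (a : ℕ) : PadicAlgCl p :=
  algebraMap ℚ_[p] (PadicAlgCl p)
    (WittVector.equiv p (WittVector.teichmuller p (a : ZMod p)) : ℤ_[p])

/-- The polynomial
`∑_{k=0}^{p-1} (-1)^k / k! T^k + ∑_{k=1}^{p-1} (-1)^k (β k - H_k) / k! T^{p+k}`,
with `H_k` the `k`-th harmonic number. -/
def recPoly (p : ℕ) (β : ℚ) : ℚ[X] :=
  ∑ k ∈ Finset.range p, C ((-1) ^ k / (k ! : ℚ)) * X ^ k +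
    ∑ k ∈ Finset.Ico 1 p, C ((-1) ^ k * (β * k - harmonic k) / (k ! : ℚ)) * X ^ (p + k)

/-- The recurrence polynomial at level `3`, with coefficients `(-1)^k (k - H_k) / k!` in the
second sum. -/
def R3 (p : ℕ) : ℚ[X] := recPoly p 1

/-- The recurrence polynomial at all levels `≥ 4`, with coefficients `(-1)^k (2 k - H_k) / k!` in
the second sum. -/
def R4 (p : ℕ) : ℚ[X] := recPoly p 2

/-- The elements `π^{m,1}`, where `ζ m` stands for `ζ_{p^m}`, `ρ` for `p^{1/p}`, `ω` for
`ζ_{2(p-1)}` and `s` for `p^{1/(p(p-1))}`. The values at `m = 0, 1` are not used. -/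
def unif (p : ℕ) [Fact p.Prime] (ζ : ℕ → PadicAlgCl p) (ρ ω s : PadicAlgCl p) :
    ℕ → PadicAlgCl p
  | 0 => 0
  | 1 => 0
  | 2 => ρ⁻¹ * (ζ 2 - ∑ k ∈ Finset.range p, (teich p (k !))⁻¹ * ω ^ k * s ^ k)
  | 3 => (ζ 3 - 1) ^ (-2 * (p : ℤ) + 2) * (ζ 3 - aeval (unif p ζ ρ ω s 2) (R3 p))
  | m + 4 => (ζ (m + 4) - 1) ^ (-2 * (p : ℤ) + 2) *
      (ζ (m + 4) - aeval (unif p ζ ρ ω s (m + 3)) (R4 p))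

end FalseTate

end

open Polynomial
open scoped NNReal Nat

noncomputable section

/-! Write R_β for `recPolyInt p β`, E for the exponential series cut below degree p, and S for
`truncEin p`. The engine is the Frobenius congruence R(x)^p ≡ R(x^p) mod p: an expansion of ζ_{p^m}
in x^p almost yields, by extracting a p-th root, an expansion of ζ_{p^{m+1}} in x.

The invariant is `LevelCongruence`: with t = x^p and modulo t^{2p}, which divides p, z = R_β(t) +
t^{2p-2}(x + (1-c)x^{p+1}). If z'^p = z, then D = z' - R_β(x) satisfies D^p ≡ x^{p(2p-2)}(x +
(1-c)x^{p+1}), so x^{2p-2} divides D. As z' - 1 is -x times a unit, D = (z'-1)^{2p-2} u with u^p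
associated to x. Modulo x^{2p} one finds x = u^p + c u^{p(p+1)}, and inserting this in R_β gives
R_{β+c} at u^p, with new c equal to 0 (`recurrence_mod`, `LevelCongruence.step`). The start is (β,
c) = (1, 1); hence R_1 is used at level 3 and R_2 at all later levels.

For the start, w = ωs satisfies w^{p-1} = -ρ, so w^{p(p-1)} = -p. If F lifts E mod p with F = 1 + X
+ ..., then (F^p - F(X^p))/p is X + aX^p + X^p S up to multiples of p and of X^{2p}
(`exists_frobenius_quotient`). Used at w^p this expands ζ_p; used at w it expresses x^p through w,
where x = π^{2,1}, and the unknown a cancels. Eliminating w produces R_1 because R_1(-y) ≡ E(y)(1 -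
y^p S(y)) mod y^{2p}; the terms k - H_k are the coefficients of E·S.

Finally |x^p| = |w| and |u^p| = |x| give the valuations. The field has degree at most N = p^m(p-1),
and an element of norm p^{-1/N} forces equality and is a uniformizer (`isUniformizer_of_norm_eq`).
Membership in the field reduces to that of w, a Krasner-type argument (`mem_of_pow_pred_mem`). -/

namespace FalseTate

/-! ### Integrality of the coefficients and the harmonic number identity. -/

section Coefficients

variable (p : ℕ) [hp : Fact p.Prime]

/-- The `p`-adic integer `1 / k!`, for `k < p`. -/
def invFact (k : ℕ) : ℤ_[p] := Ring.inverse (k ! : ℤ_[p])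

/-- The `p`-adic integer `H_k`, for `k < p`. -/
def harmInt (k : ℕ) : ℤ_[p] := ∑ i ∈ Finset.range k, Ring.inverse ((i + 1 : ℕ) : ℤ_[p])

/-- The truncated exponential series `∑_{k < n} X^k / k!`. -/
def truncExp (n : ℕ) : ℤ_[p][X] := ∑ k ∈ Finset.range n, C (invFact p k) * X ^ k

/-- The polynomial `∑_{2 ≤ k < p} (-1)^k X^k / (k · k!)`. -/
def truncEin : ℤ_[p][X] :=
  ∑ k ∈ Finset.Ico 2 p, C ((-1) ^ k * invFact p k * Ring.inverse (k : ℤ_[p])) * X ^ k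

/-- The polynomial `recPoly p β` over `ℤ_[p]`. -/
def recPolyInt (β : ℤ_[p]) : ℤ_[p][X] :=
  ∑ k ∈ Finset.range p, C ((-1) ^ k * invFact p k) * X ^ k +
    ∑ k ∈ Finset.Ico 1 p, C ((-1) ^ k * (β * k - harmInt p k) * invFact p k) * X ^ (p + k)

variable {p}

lemma isUnit_natCast {k : ℕ} (hk : ¬ p ∣ k) : IsUnit (k : ℤ_[p]) := by
  rw [PadicInt.isUnit_iff, PadicInt.norm_natCast_eq_one_iff]
  exact (hp.out.coprime_iff_not_dvd).2 hk

omit hp in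
lemma not_dvd_of_pos_of_lt {k : ℕ} (h0 : 0 < k) (hk : k < p) : ¬ p ∣ k :=
  Nat.not_dvd_of_pos_of_lt h0 hk

lemma isUnit_factorial {k : ℕ} (hk : k < p) : IsUnit (k ! : ℤ_[p]) :=
  isUnit_natCast fun h => absurd ((hp.out.dvd_factorial).1 h) (not_le.2 hk)

lemma factorial_mul_invFact {k : ℕ} (hk : k < p) : (k ! : ℤ_[p]) * invFact p k = 1 :=
  Ring.mul_inverse_cancel _ (isUnit_factorial hk)

lemma invFact_zero : invFact p 0 = 1 := by simp [invFact]

lemma invFact_one : invFact p 1 = 1 := by simp [invFact]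

lemma succ_mul_invFact_succ {k : ℕ} (hk : k + 1 < p) :
    ((k + 1 : ℕ) : ℤ_[p]) * invFact p (k + 1) = invFact p k := by
  have h1 := factorial_mul_invFact (p := p) hk
  have h2 := factorial_mul_invFact (p := p) (k := k) (by omega)
  rw [Nat.factorial_succ, Nat.cast_mul] at h1
  linear_combination (norm := ring_nf) invFact p k * h1 -
    ((k + 1 : ℕ) : ℤ_[p]) * invFact p (k + 1) * h2

lemma coe_inverse {a : ℤ_[p]} (ha : IsUnit a) :
    ((Ring.inverse a : ℤ_[p]) : ℚ_[p]) = (a : ℚ_[p])⁻¹ := by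
  refine eq_inv_of_mul_eq_one_left ?_
  rw [← PadicInt.coe_mul, Ring.inverse_mul_cancel _ ha, PadicInt.coe_one]

lemma coe_invFact {k : ℕ} (hk : k < p) : (invFact p k : ℚ_[p]) = (k ! : ℚ_[p])⁻¹ := by
  rw [invFact, coe_inverse (isUnit_factorial hk)]; simp

lemma coe_harmInt {k : ℕ} (hk : k < p) :
    (harmInt p k : ℚ_[p]) = ((harmonic k : ℚ) : ℚ_[p]) := by
  induction k with
  | zero => simp [harmInt]
  | succ k ih =>
    have h := ih (by omega)
    rw [harmInt] at h
    rw [harmInt, Finset.sum_range_succ, PadicInt.coe_add, h, harmonic_succ,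
      coe_inverse (isUnit_natCast (not_dvd_of_pos_of_lt (by omega) hk))]
    push_cast
    ring

lemma map_recPolyInt (β : ℕ) :
    (recPolyInt p (β : ℤ_[p])).map PadicInt.Coe.ringHom =
      (recPoly p (β : ℚ)).map (algebraMap ℚ ℚ_[p]) := by
  rw [recPolyInt, recPoly]
  simp only [Polynomial.map_add, Polynomial.map_sum, Polynomial.map_mul, Polynomial.map_C,
    Polynomial.map_pow, Polynomial.map_X]
  congr 1
  · refine Finset.sum_congr rfl fun k hk => ?_
    have hk' := Finset.mem_range.1 hk
    congr 2
    have := coe_invFact hk'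
    change ((((-1) ^ k * invFact p k : ℤ_[p])) : ℚ_[p]) = _
    simp [this, div_eq_mul_inv]
  · refine Finset.sum_congr rfl fun k hk => ?_
    have hk' := (Finset.mem_Ico.1 hk).2
    congr 2
    have h1 := coe_invFact hk'
    have h2 := coe_harmInt hk'
    change ((((-1) ^ k * ((β : ℤ_[p]) * k - harmInt p k) * invFact p k : ℤ_[p])) : ℚ_[p]) = _
    simp [h1, h2, div_eq_mul_inv]

lemma not_dvd_den_coeff_recPoly (β : ℕ) (k : ℕ) :
    ¬ p ∣ ((recPoly p (β : ℚ)).coeff k).den := by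
  have h : algebraMap ℚ ℚ_[p] ((recPoly p (β : ℚ)).coeff k) =
      ((recPolyInt p (β : ℤ_[p])).coeff k : ℚ_[p]) := by
    have := congrArg (fun f => f.coeff k) (map_recPolyInt (p := p) β)
    simp only [coeff_map] at this
    exact this.symm
  have h1 : ‖(((recPoly p (β : ℚ)).coeff k : ℚ) : ℚ_[p])‖ ≤ 1 := by
    have h2 : (((recPoly p (β : ℚ)).coeff k : ℚ) : ℚ_[p]) =
      ((recPolyInt p (β : ℤ_[p])).coeff k : ℚ_[p]) := by simpa using h
    rw [h2]
    exact PadicInt.norm_le_one _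
  intro hd
  set q := (recPoly p (β : ℚ)).coeff k with hq
  have hn : ¬ (p : ℤ) ∣ q.num := fun hn =>
    hp.out.one_lt.ne' (Nat.dvd_one.1 (q.reduced ▸ Nat.dvd_gcd (Int.natCast_dvd.1 hn) hd))
  rw [← Padic.norm_intCast_lt_one_iff] at hn
  refine hn ?_
  have hmul : ((q : ℚ) : ℚ_[p]) * (q.den : ℚ_[p]) = ((q.num : ℤ) : ℚ_[p]) := by
    exact_mod_cast congrArg (fun r : ℚ => (r : ℚ_[p])) (Rat.mul_den_eq_num q)
  rw [← hmul, norm_mul]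
  exact mul_lt_one_of_nonneg_of_lt_one_right h1 (norm_nonneg _)
    (Padic.norm_natCast_lt_one_iff.2 hd)

/-- Induction by Pascal's rule: the increment is 1/(j+1) times an alternating sum of binomials (j+1
choose k) lacking its k = 0 term. -/
lemma sum_neg_one_pow_choose_div (j : ℕ) :
    ∑ k ∈ Finset.Ico 1 (j + 1), (-1 : ℚ) ^ k * (j.choose k) / k = - harmonic j := by
  induction j with
  | zero => simp
  | succ j ih =>
    have key : ∑ k ∈ Finset.Ico 1 (j + 2), (-1 : ℚ) ^ k * (j.choose (k - 1)) / k =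
        - ((j + 1 : ℕ) : ℚ)⁻¹ := by
      have h1 : ∀ k ∈ Finset.Ico 1 (j + 2), (-1 : ℚ) ^ k * (j.choose (k - 1)) / k =
          ((j + 1 : ℕ) : ℚ)⁻¹ * ((-1 : ℚ) ^ k * ((j + 1).choose k)) := by
        intro k hk
        obtain ⟨k, rfl⟩ : ∃ l, k = l + 1 := ⟨k - 1, by have := Finset.mem_Ico.1 hk; omega⟩
        have h2 : ((j + 1 : ℕ) : ℚ) * (j.choose k) = ((j + 1).choose (k + 1)) * ((k + 1 : ℕ) : ℚ) := by
          exact_mod_cast Nat.add_one_mul_choose_eq j k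
        have h3 : ((j + 1 : ℕ) : ℚ) ≠ 0 := by positivity
        have h4 : ((k + 1 : ℕ) : ℚ) ≠ 0 := by positivity
        rw [Nat.add_sub_cancel, div_eq_iff h4]
        field_simp
        linear_combination h2
      rw [Finset.sum_congr rfl h1, ← Finset.mul_sum]
      have h5 : ∑ k ∈ Finset.range (j + 2), (-1 : ℚ) ^ k * ((j + 1).choose k) = 0 := by
        have := Int.alternating_sum_range_choose_of_ne (n := j + 1) (by omega)
        exact_mod_cast this
      rw [Finset.range_eq_Ico, Finset.sum_eq_sum_Ico_succ_bot (by omega)] at h5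
      simp only [zero_add, pow_zero, Nat.choose_zero_right] at h5
      have h6 : ∑ k ∈ Finset.Ico 1 (j + 2), (-1 : ℚ) ^ k * ((j + 1).choose k) = -1 := by
        push_cast at h5; linarith
      rw [h6]; ring
    rw [harmonic_succ, neg_add, ← ih, ← key]
    have h7 : ∑ k ∈ Finset.Ico 1 (j + 1), (-1 : ℚ) ^ k * (j.choose k) / k =
        ∑ k ∈ Finset.Ico 1 (j + 2), (-1 : ℚ) ^ k * (j.choose k) / k := by
      rw [Finset.sum_Ico_succ_top (show 1 ≤ j + 1 by omega)]
      simp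
    rw [h7, ← Finset.sum_add_distrib]
    refine Finset.sum_congr rfl fun k hk => ?_
    obtain ⟨k, rfl⟩ : ∃ l, k = l + 1 := ⟨k - 1, by have := Finset.mem_Ico.1 hk; omega⟩
    rw [Nat.choose_succ_succ, Nat.add_sub_cancel]
    push_cast
    ring

/-- The coefficients of the product of `truncExp` and `truncEin`. -/
lemma sum_invFact_mul_invFact {j : ℕ} (hj : 1 ≤ j) (hjp : j < p) :
    ∑ k ∈ Finset.Ico 2 (j + 1), (-1) ^ k * invFact p k * Ring.inverse (k : ℤ_[p]) *
      invFact p (j - k) = ((j : ℤ_[p]) - harmInt p j) * invFact p j := by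
  apply PadicInt.ext
  have hcast : ∀ k ∈ Finset.Ico 2 (j + 1), (((-1) ^ k * invFact p k *
      Ring.inverse (k : ℤ_[p]) * invFact p (j - k) : ℤ_[p]) : ℚ_[p]) =
      (((-1 : ℚ) ^ k * (j.choose k) / k * (j ! : ℚ)⁻¹ : ℚ) : ℚ_[p]) := by
    intro k hk
    obtain ⟨h2, hkj⟩ := Finset.mem_Ico.1 hk
    simp only [PadicInt.coe_mul, PadicInt.coe_pow, PadicInt.coe_neg, PadicInt.coe_one]
    rw [coe_invFact (by omega), coe_invFact (by omega),
      coe_inverse (isUnit_natCast (not_dvd_of_pos_of_lt (by omega) (by omega))),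
      Nat.cast_choose ℚ (show k ≤ j by omega)]
    have h1 : (j ! : ℚ_[p]) ≠ 0 := by exact_mod_cast Nat.factorial_ne_zero j
    push_cast
    field_simp
  -- The omitted term k = 1 equals -j; this turns -H_j into j - H_j.
  have hsum : ∑ k ∈ Finset.Ico 2 (j + 1), (-1 : ℚ) ^ k * (j.choose k) / k =
      j - harmonic j := by
    have := sum_neg_one_pow_choose_div j
    rw [Finset.sum_eq_sum_Ico_succ_bot (by omega)] at this
    simp only [pow_one, Nat.choose_one_right, Nat.cast_one, div_one] at this
    linarith
  have hco : ((∑ k ∈ Finset.Ico 2 (j + 1), (-1) ^ k * invFact p k *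
      Ring.inverse (k : ℤ_[p]) * invFact p (j - k) : ℤ_[p]) : ℚ_[p]) =
      ∑ k ∈ Finset.Ico 2 (j + 1), (((-1) ^ k * invFact p k *
      Ring.inverse (k : ℤ_[p]) * invFact p (j - k) : ℤ_[p]) : ℚ_[p]) :=
    map_sum PadicInt.Coe.ringHom _ _
  rw [hco, Finset.sum_congr rfl hcast, ← Rat.cast_sum, ← Finset.sum_mul, hsum]
  simp [coe_invFact hjp, coe_harmInt hjp]

end Coefficients

/-! ### The Frobenius quotient of a lift of the truncated exponential. -/

section FrobeniusQuotient

variable {p : ℕ} [hp : Fact p.Prime]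

lemma truncExp_succ (n : ℕ) :
    truncExp p (n + 1) = truncExp p n + C (invFact p n) * X ^ n :=
  Finset.sum_range_succ _ _

lemma derivative_truncExp {n : ℕ} (hn : n < p) :
    derivative (truncExp p (n + 1)) = truncExp p n := by
  induction n with
  | zero => simp [truncExp]
  | succ n ih =>
    rw [truncExp_succ, derivative_add, ih (by omega), derivative_C_mul_X_pow, truncExp_succ,
      Nat.add_sub_cancel, mul_comm (invFact p (n + 1)), succ_mul_invFact_succ hn]

lemma toZMod_invFact_pred : PadicInt.toZMod (invFact p (p - 1)) = -1 := by
  have h1 := congrArg PadicInt.toZMod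
    (factorial_mul_invFact (p := p) (Nat.sub_lt hp.out.pos one_pos))
  rw [map_mul, map_natCast, ZMod.wilsons_lemma, map_one] at h1
  linear_combination -h1

/-- The reduction of the truncated exponential modulo `p`. -/
def truncExpMod (p : ℕ) [Fact p.Prime] : (ZMod p)[X] := (truncExp p p).map PadicInt.toZMod

/-- Differentiation removes the top term, whose coefficient 1/(p-1)! is -1 by Wilson's theorem. -/
lemma derivative_truncExpMod :
    derivative (truncExpMod p) = truncExpMod p + X ^ (p - 1) := by
  have hp1 : p - 1 + 1 = p := Nat.sub_add_cancel hp.out.one_le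
  have h1 : derivative (truncExp p p) = truncExp p (p - 1) := by
    have := derivative_truncExp (p := p) (n := p - 1) (Nat.sub_lt hp.out.pos one_pos)
    rwa [hp1] at this
  have h2 : truncExp p p = truncExp p (p - 1) + C (invFact p (p - 1)) * X ^ (p - 1) := by
    have := truncExp_succ (p := p) (p - 1)
    rwa [hp1] at this
  rw [truncExpMod, derivative_map, h1, h2, Polynomial.map_add, Polynomial.map_mul,
    Polynomial.map_C, toZMod_invFact_pred, Polynomial.map_pow, Polynomial.map_X]
  simp

lemma coeff_truncExp {n k : ℕ} (hk : k < n) : (truncExp p n).coeff k = invFact p k := by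
  simp [truncExp, coeff_X_pow, hk]

lemma coeff_eq_zero_of_X_pow_dvd_derivative {f : (ZMod p)[X]} {n j : ℕ}
    (h : X ^ n ∣ derivative f) (hj : j ≠ 0) (hjn : j ≤ n) (hpj : ¬ p ∣ j) : f.coeff j = 0 := by
  obtain ⟨j, rfl⟩ := Nat.exists_eq_succ_of_ne_zero hj
  have h1 := (X_pow_dvd_iff.1 h) j (by omega)
  rw [coeff_derivative] at h1
  refine (mul_eq_zero.1 h1).resolve_right fun h0 => hpj ?_
  rw [← ZMod.natCast_eq_zero_iff]
  exact_mod_cast h0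

/-- The analogue of e^X e^{-X} = 1: by `derivative_truncExpMod` the derivative of the product is
divisible by X^{p-1}, which kills the coefficients of index strictly between 0 and p. -/
lemma truncExpMod_mul_comp_neg (hp2 : p ≠ 2) :
    ∃ a, truncExpMod p * (truncExpMod p).comp (-X) = 1 + X ^ p * a := by
  have hodd : Even (p - 1) := hp.out.even_sub_one hp2
  have hd : X ^ (p - 1) ∣ derivative (truncExpMod p * (truncExpMod p).comp (-X)) := by
    rw [derivative_mul, derivative_comp, derivative_truncExpMod]
    simp only [derivative_neg, derivative_X, add_comp, pow_comp, X_comp, hodd.neg_pow]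
    exact ⟨(truncExpMod p).comp (-X) - truncExpMod p, by ring⟩
  have h : X ^ p ∣ truncExpMod p * (truncExpMod p).comp (-X) - 1 := by
    rw [X_pow_dvd_iff]
    intro j hj
    rw [coeff_sub, coeff_one]
    rcases eq_or_ne j 0 with rfl | hj0
    · have h0 : (truncExpMod p).coeff 0 = 1 := by
        rw [truncExpMod, coeff_map, coeff_truncExp hp.out.pos, invFact_zero, map_one]
      rw [mul_coeff_zero, coeff_zero_eq_eval_zero ((truncExpMod p).comp (-X)), eval_comp]
      simp [← coeff_zero_eq_eval_zero, h0]
    · rw [coeff_eq_zero_of_X_pow_dvd_derivative hd hj0 (by omega)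
        (not_dvd_of_pos_of_lt (Nat.pos_of_ne_zero hj0) hj)]
      simp [hj0]
  obtain ⟨a, ha⟩ := h
  exact ⟨a, by rw [← ha]; ring⟩

lemma truncExpMod_comp_neg :
    (truncExpMod p).comp (-X) = X * derivative ((truncEin p).map PadicInt.toZMod) + 1 - X := by
  have h1 : truncExpMod p = ∑ k ∈ Finset.range p, C (PadicInt.toZMod (invFact p k)) * X ^ k := by
    simp [truncExpMod, truncExp, Polynomial.map_sum]
  have h2 : (truncExpMod p).comp (-X) =
      ∑ k ∈ Finset.range p, C (PadicInt.toZMod ((-1) ^ k * invFact p k)) * X ^ k := by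
    rw [h1, Polynomial.sum_comp]
    refine Finset.sum_congr rfl fun k _ => ?_
    rw [mul_comp, C_comp, pow_comp, X_comp, map_mul, neg_pow]
    simp
    ring
  have h3 : X * derivative ((truncEin p).map PadicInt.toZMod) =
      ∑ k ∈ Finset.Ico 2 p, C (PadicInt.toZMod ((-1) ^ k * invFact p k)) * X ^ k := by
    rw [truncEin, Polynomial.map_sum, derivative_sum, Finset.mul_sum]
    refine Finset.sum_congr rfl fun k hk => ?_
    obtain ⟨hk2, hkp⟩ := Finset.mem_Ico.1 hk
    have hu := Ring.inverse_mul_cancel _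
      (isUnit_natCast (p := p) (not_dvd_of_pos_of_lt (k := k) (by omega) hkp))
    rw [Polynomial.map_mul, Polynomial.map_C, Polynomial.map_pow, Polynomial.map_X,
      derivative_C_mul_X_pow, ← mul_left_comm, ← pow_succ', Nat.sub_add_cancel (by omega)]
    congr 2
    rw [← map_natCast (PadicInt.toZMod (p := p)) k, ← map_mul]
    congr 1
    linear_combination ((-1) ^ k * invFact p k) * hu
  rw [h2, h3, Finset.range_eq_Ico, Finset.sum_eq_sum_Ico_succ_bot hp.out.pos,
    Finset.sum_eq_sum_Ico_succ_bot hp.out.one_lt]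
  simp [invFact_zero, invFact_one]
  ring

lemma expand_truncExpMod :
    ∃ b, expand (ZMod p) p (truncExpMod p) = 1 + X ^ p + X ^ (2 * p) * b := by
  have h : X ^ 2 ∣ truncExpMod p - 1 - X := by
    rw [X_pow_dvd_iff]
    intro j hj
    have hj2 : j < p := lt_of_lt_of_le hj hp.out.two_le
    rw [coeff_sub, coeff_sub, truncExpMod, coeff_map, coeff_truncExp hj2]
    interval_cases j <;> simp [invFact_zero, invFact_one, coeff_X, coeff_one]
  obtain ⟨b, hb⟩ := h
  refine ⟨expand (ZMod p) p b, ?_⟩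
  rw [show truncExpMod p = 1 + X + X ^ 2 * b by rw [← hb]; ring]
  simp [← pow_mul, mul_comm]

lemma exists_eq_X_pow_mul_add {R : Type*} [CommRing R] {f : R[X]} {n : ℕ} {c : R}
    (h : ∀ j < n, c ∣ f.coeff j) : ∃ M N, f = X ^ n * M + C c * N := by
  choose! q hq using h
  set N : R[X] := ∑ j ∈ Finset.range n, C (q j) * X ^ j with hN
  have h1 : X ^ n ∣ f - C c * N := by
    rw [X_pow_dvd_iff]
    intro j hj
    rw [coeff_sub, coeff_C_mul, hN]
    simp [coeff_X_pow, hj, hq j hj]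
  obtain ⟨M, hM⟩ := h1
  exact ⟨M, N, by rw [← hM]; ring⟩

lemma toZMod_eq_zero_iff (a : ℤ_[p]) : PadicInt.toZMod a = 0 ↔ (p : ℤ_[p]) ∣ a := by
  rw [← RingHom.mem_ker, PadicInt.ker_toZMod, PadicInt.maximalIdeal_eq_span_p,
    Ideal.mem_span_singleton]

/-- A lift of the Frobenius congruence. -/
lemma exists_pow_eq_expand_add (f : ℤ_[p][X]) :
    ∃ Q, f ^ p = expand ℤ_[p] p f + C (p : ℤ_[p]) * Q := by
  have h : C (p : ℤ_[p]) ∣ f ^ p - expand ℤ_[p] p f := by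
    rw [C_dvd_iff_dvd_coeff]
    intro j
    rw [← toZMod_eq_zero_iff, ← coeff_map]
    rw [Polynomial.map_sub, Polynomial.map_pow, map_expand, ZMod.expand_card]
    simp
  obtain ⟨Q, hQ⟩ := h
  exact ⟨Q, by rw [← hQ]; ring⟩

/-- Q involves a division by p, but p cancels in its derivative, which can therefore be computed mod
p from f mod p. -/
lemma derivative_of_pow_eq_expand_add {f Q : ℤ_[p][X]}
    (h : f ^ p = expand ℤ_[p] p f + C (p : ℤ_[p]) * Q) :
    derivative Q = f ^ (p - 1) * derivative f -
      X ^ (p - 1) * expand ℤ_[p] p (derivative f) := by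
  have h1 := congrArg derivative h
  rw [derivative_pow, derivative_add, derivative_expand, derivative_C_mul] at h1
  have hp0 : (C (p : ℤ_[p]) : ℤ_[p][X]) ≠ 0 := by
    simpa using hp.out.ne_zero
  refine mul_left_cancel₀ hp0 ?_
  have h2 : ((p : ℕ) : ℤ_[p][X]) = C (p : ℤ_[p]) := (C_eq_natCast p).symm
  rw [h2] at h1
  linear_combination -h1

/-- The quotient `(F^p - F(X^p)) / p` for a lift `F` of the truncated exponential. -/
lemma exists_frobenius_quotient (hp2 : p ≠ 2) {F Q : ℤ_[p][X]}
    (hQ : F ^ p = expand ℤ_[p] p F + C (p : ℤ_[p]) * Q)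
    (hF : F.map PadicInt.toZMod = truncExpMod p) (hF0 : F.coeff 0 = 1) (hF1 : F.coeff 1 = 1) :
    ∃ (c : ℤ_[p]) (M N : ℤ_[p][X]),
      Q = X + C c * X ^ p + X ^ p * truncEin p + X ^ (2 * p) * M + C (p : ℤ_[p]) * X ^ 2 * N := by
  have hpp := hp.out.pos
  have h3 : 3 ≤ p := by have := hp.out.two_le; omega
  have hd := derivative_of_pow_eq_expand_add hQ
  -- The derivative mod p does not see the coefficient of X^p, so it is carried along as an unknown.
  set c := Q.coeff p - (X ^ p * truncEin p).coeff p with hc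
  set G := Q - (X + C c * X ^ p + X ^ p * truncEin p) with hG
  have hein0 : (truncEin p).coeff 0 = 0 := by
    simp only [truncEin, finsetSum_coeff, coeff_C_mul, coeff_X_pow]
    refine Finset.sum_eq_zero fun k hk => ?_
    rw [if_neg (by have := Finset.mem_Ico.1 hk; omega), mul_zero]
  have hQ0 : Q.coeff 0 = 0 := by
    have h1 := congrArg (fun f => coeff f 0) hQ
    simp only [coeff_zero_eq_eval_zero, eval_pow, eval_add, expand_eval, eval_mul, eval_C] at h1
    rw [zero_pow hpp.ne', ← coeff_zero_eq_eval_zero, hF0, one_pow, left_eq_add] at h1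
    rw [coeff_zero_eq_eval_zero]
    exact (mul_eq_zero.1 h1).resolve_left (by exact_mod_cast hp.out.ne_zero)
  have hQ1 : Q.coeff 1 = 1 := by
    have h1 := congrArg (fun f => coeff f 0) hd
    simp only [coeff_derivative, coeff_sub, mul_coeff_zero, coeff_X_pow,
      if_neg (show ¬ 0 = p - 1 by omega), hF1] at h1
    rw [coeff_zero_eq_eval_zero (F ^ _), eval_pow, ← coeff_zero_eq_eval_zero, hF0] at h1
    simpa using h1
  have hG0 : G.coeff 0 = 0 := by
    simp [hG, hQ0, hpp.ne]
  have hG1 : G.coeff 1 = 0 := by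
    simp [hG, hQ1, coeff_X_pow_mul', coeff_X_pow, show ¬ 1 = p by omega, show ¬ p ≤ 1 by omega]
  -- Mod p and X^p, E^{p-1} is E(-X) = 1 - X + X S'. With E^p ≡ 1 + X^p mod X^{2p}, this gives Q' ≡
  -- 1 + X^p + X^{p-1}(E(-X) - 1) = 1 + X^p S' mod X^{2p-1}.
  have hGd : X ^ (2 * p - 1) ∣ derivative (G.map PadicInt.toZMod) := by
    obtain ⟨a, ha⟩ := truncExpMod_mul_comp_neg hp2
    obtain ⟨b, hb⟩ := expand_truncExpMod (p := p)
    rw [ZMod.expand_card] at hb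
    have hE := derivative_truncExpMod (p := p)
    have hexp : expand (ZMod p) p (derivative (truncExpMod p)) =
        truncExpMod p ^ p + X ^ (p * (p - 1)) := by
      rw [ZMod.expand_card, hE, add_pow_char, ← pow_mul, mul_comm p]
    have hQd : derivative (Q.map PadicInt.toZMod) = truncExpMod p ^ (p - 1) *
        derivative (truncExpMod p) -
        X ^ (p - 1) * expand (ZMod p) p (derivative (truncExpMod p)) := by
      rw [derivative_map, hd, ← hF, derivative_map, Polynomial.map_sub, Polynomial.map_mul,
        Polynomial.map_mul, map_expand, Polynomial.map_pow, Polynomial.map_pow, Polynomial.map_X]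
    have hXp : derivative (X ^ p : (ZMod p)[X]) = 0 := by
      rw [derivative_X_pow, CharP.cast_eq_zero, map_zero, zero_mul]
    have hGm : derivative (G.map PadicInt.toZMod) = truncExpMod p ^ (p - 1) *
        (truncExpMod p + X ^ (p - 1)) - X ^ (p - 1) * (truncExpMod p ^ p + X ^ (p * (p - 1))) -
        1 - X ^ p * derivative ((truncEin p).map PadicInt.toZMod) := by
      rw [hG, Polynomial.map_sub, derivative_sub, hQd, hexp, hE]
      simp only [Polynomial.map_add, Polynomial.map_mul, Polynomial.map_X, Polynomial.map_C,
        Polynomial.map_pow, derivative_add, derivative_mul, hXp, derivative_C, derivative_X]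
      ring
    have hein := truncExpMod_comp_neg (p := p)
    set A := truncExpMod p
    set B := A.comp (-X)
    set S := derivative ((truncEin p).map PadicInt.toZMod)
    have hs : A ^ p = A ^ (p - 1) * A := by
      rw [← pow_succ, Nat.sub_add_cancel hpp]
    have hx : (X : (ZMod p)[X]) ^ p = X ^ (p - 1) * X := by
      rw [← pow_succ, Nat.sub_add_cancel hpp]
    have hx2 : (X : (ZMod p)[X]) ^ (2 * p - 1) = X ^ (p - 1) * X ^ p := by
      rw [← pow_add]; congr 1; omega
    have hx3 : (X : (ZMod p)[X]) ^ (2 * p) = X ^ (p - 1) * X ^ p * X := by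
      rw [← hx2, ← pow_succ]; congr 1; omega
    have hx4 : (X : (ZMod p)[X]) ^ (p * (p - 1)) = X ^ p * X ^ (p * (p - 2)) := by
      rw [← pow_add]; congr 1
      obtain ⟨q, rfl⟩ : ∃ q, p = q + 2 := ⟨p - 2, by omega⟩
      simp only [Nat.add_sub_cancel, show q + 2 - 1 = q + 1 by omega]
      ring
    rw [hx2, hGm, hx4]
    rw [hx3] at hb
    rw [hx] at ha hb ⊢
    generalize (X : (ZMod p)[X]) ^ (p - 1) = Y at *
    generalize (X : (ZMod p)[X]) ^ (p * (p - 2)) = Z at *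
    generalize A ^ (p - 1) = A' at *
    generalize A ^ p = P at *
    have hA1 : A' = B + Y * X * (B + Y * X * b * B - A' * a) := by
      linear_combination (-A') * ha + B * hb - B * hs
    refine ⟨X * b - 1 - Y * X * b + (B + Y * X * b * B - A' * a) - Z, ?_⟩
    linear_combination (1 - Y) * hb + Y * hA1 + Y * hein - hs
  have hdvd : ∀ j < 2 * p, (p : ℤ_[p]) ∣ G.coeff j := by
    intro j hj
    rw [← toZMod_eq_zero_iff, ← coeff_map]
    rcases eq_or_ne j 0 with rfl | hj0
    · rw [coeff_map, hG0, map_zero]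
    rcases eq_or_ne j p with rfl | hjp
    · rw [coeff_map]
      have : G.coeff j = 0 := by
        rw [hG, coeff_sub, coeff_add, coeff_add, coeff_C_mul, coeff_X_pow_self, coeff_X,
          if_neg (by omega), hc]
        ring
      rw [this, map_zero]
    refine coeff_eq_zero_of_X_pow_dvd_derivative hGd hj0 (by omega) ?_
    rintro ⟨t, rfl⟩
    have : t < 2 := by
      by_contra h
      have := Nat.mul_le_mul_left p (not_lt.1 h)
      omega
    interval_cases t <;> simp at hj0 hjp
  -- Coefficients 0 and 1 vanish over ℤ_p, not only mod p; hence the factor X^2 in the error term p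
  -- X^2 N.
  have hX2 : X ^ 2 ∣ G := by
    rw [X_pow_dvd_iff]
    intro j hj
    interval_cases j
    · exact hG0
    · exact hG1
  obtain ⟨G', hG'⟩ := hX2
  obtain ⟨M, N, hMN⟩ := exists_eq_X_pow_mul_add (f := G') (n := 2 * p - 2) (c := (p : ℤ_[p]))
    (fun j hj => by
      have := hdvd (j + 2) (by omega)
      rwa [hG', mul_comm, coeff_mul_X_pow] at this)
  refine ⟨c, M, N, ?_⟩
  have h2p : (X : ℤ_[p][X]) ^ (2 * p) = X ^ 2 * X ^ (2 * p - 2) := by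
    rw [← pow_add]; congr 1; omega
  rw [show Q = G + (X + C c * X ^ p + X ^ p * truncEin p) by rw [hG]; ring, hG', hMN, h2p]
  ring

end FrobeniusQuotient

/-! ### Teichmüller representatives and the polynomial with coefficients 1/[k!]. -/

section Teichmuller

variable {p : ℕ} [hp : Fact p.Prime]

/-- The Teichmüller representative as a `p`-adic integer. -/
def teichInt (p : ℕ) [Fact p.Prime] (a : ℕ) : ℤ_[p] :=
  WittVector.equiv p (WittVector.teichmuller p (a : ZMod p))

/-- After subtracting a natural number lifting the residue, x has zero constant coefficient, so it
is not a unit; its image is not a unit either, and non-units of ℤ_p reduce to 0. -/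
lemma toZMod_wittVector_equiv (x : WittVector p (ZMod p)) :
    PadicInt.toZMod (WittVector.equiv p x) = x.coeff 0 := by
  set n := (x.coeff 0).val
  have hn : (n : ZMod p) = x.coeff 0 := ZMod.natCast_zmod_val _
  have h1 : WittVector.constantCoeff (x - (n : WittVector p (ZMod p))) = 0 := by
    rw [map_sub, map_natCast, hn]
    simp [WittVector.constantCoeff]
  have h2 : ¬ IsUnit (WittVector.equiv p (x - (n : WittVector p (ZMod p)))) := by
    intro h
    have h3 : IsUnit (x - (n : WittVector p (ZMod p))) := by
      simpa using h.map (WittVector.equiv p).symm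
    have h4 := h3.map (WittVector.constantCoeff (p := p) (R := ZMod p))
    rw [h1] at h4
    exact not_isUnit_zero h4
  have h5 : PadicInt.toZMod (WittVector.equiv p (x - (n : WittVector p (ZMod p)))) = 0 := by
    rw [← RingHom.mem_ker, PadicInt.ker_toZMod]
    exact h2
  rw [map_sub, map_sub, map_natCast, map_natCast, sub_eq_zero, hn] at h5
  exact h5

lemma toZMod_teichInt (a : ℕ) : PadicInt.toZMod (teichInt p a) = a := by
  rw [teichInt, toZMod_wittVector_equiv, WittVector.teichmuller_coeff_zero]

lemma teichInt_one : teichInt p 1 = 1 := by simp [teichInt]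

lemma isUnit_teichInt {a : ℕ} (ha : ¬ p ∣ a) : IsUnit (teichInt p a) := by
  by_contra h
  have h1 : PadicInt.toZMod (teichInt p a) = 0 := by
    rw [← RingHom.mem_ker, PadicInt.ker_toZMod]
    exact h
  rw [toZMod_teichInt, ZMod.natCast_eq_zero_iff] at h1
  exact ha h1

/-- The polynomial `∑_{k < p} X^k / [k!]`. -/
def teichExp (p : ℕ) [Fact p.Prime] : ℤ_[p][X] :=
  ∑ k ∈ Finset.range p, C (Ring.inverse (teichInt p (k !))) * X ^ k

lemma coeff_teichExp {k : ℕ} (hk : k < p) :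
    (teichExp p).coeff k = Ring.inverse (teichInt p (k !)) := by
  simp [teichExp, coeff_X_pow, hk]

lemma coeff_teichExp_zero : (teichExp p).coeff 0 = 1 := by
  rw [coeff_teichExp hp.out.pos, Nat.factorial_zero, teichInt_one, Ring.inverse_one]

lemma coeff_teichExp_one : (teichExp p).coeff 1 = 1 := by
  rw [coeff_teichExp hp.out.one_lt, Nat.factorial_one, teichInt_one, Ring.inverse_one]

lemma not_dvd_factorial {k : ℕ} (hk : k < p) : ¬ p ∣ k ! :=
  fun h => absurd ((hp.out.dvd_factorial).1 h) (not_le.2 hk)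

lemma map_teichExp : (teichExp p).map PadicInt.toZMod = truncExpMod p := by
  simp only [teichExp, truncExpMod, truncExp, Polynomial.map_sum, Polynomial.map_mul,
    Polynomial.map_C, Polynomial.map_pow, Polynomial.map_X]
  refine Finset.sum_congr rfl fun k hk => ?_
  have hk' := Finset.mem_range.1 hk
  congr 2
  have h1 := congrArg PadicInt.toZMod
    (Ring.mul_inverse_cancel _ (isUnit_teichInt (not_dvd_factorial hk')))
  have h2 := congrArg PadicInt.toZMod (factorial_mul_invFact (p := p) hk')
  rw [map_mul, toZMod_teichInt, map_one] at h1
  rw [map_mul, map_natCast, map_one] at h2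
  linear_combination PadicInt.toZMod (invFact p k) * h1 -
    PadicInt.toZMod (Ring.inverse (teichInt p k !)) * h2

end Teichmuller

/-! ### Binomial expansions. -/

section PowerIdentities

/-- The quadratic term is kept explicit: its coefficient (p-1)/2, which is -1/2 mod p, contributes
at the first level. -/
lemma exists_add_pow_prime_eq_of_odd {R : Type*} [CommRing R] {p : ℕ} (hp : p.Prime) (hp3 : 3 ≤ p)
    (a b : R) : ∃ r, (a + b) ^ p = a ^ p + p * (a ^ (p - 1) * b) +
      p * (((p - 1) / 2 : ℕ) * (a ^ (p - 2) * b ^ 2)) + p * (b ^ 3 * r) + b ^ p := by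
  have hch : ∀ k ∈ Finset.Ico 3 p, (p : R) * b ^ 3 ∣ b ^ k * a ^ (p - k) * (p.choose k) := by
    intro k hk
    obtain ⟨h3, hkp⟩ := Finset.mem_Ico.1 hk
    obtain ⟨m, hm⟩ := hp.dvd_choose_self (by omega) hkp
    obtain ⟨l, rfl⟩ := Nat.exists_eq_add_of_le h3
    refine ⟨b ^ l * a ^ (p - (3 + l)) * m, ?_⟩
    rw [hm, pow_add]
    push_cast
    ring
  obtain ⟨r, hr⟩ := Finset.dvd_sum hch
  refine ⟨r, ?_⟩
  have hc2 : p.choose 2 = p * ((p - 1) / 2) := by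
    rw [Nat.choose_two_right, Nat.mul_div_assoc]
    exact (hp.even_sub_one (by omega)).two_dvd
  rw [add_comm a b, add_pow, Finset.sum_range_succ, Finset.range_eq_Ico,
    Finset.sum_eq_sum_Ico_succ_bot (by omega), Finset.sum_eq_sum_Ico_succ_bot (by omega),
    Finset.sum_eq_sum_Ico_succ_bot (by omega), hr, hc2]
  simp
  ring

lemma add_pow_of_natCast_eq_zero {R : Type*} [CommRing R] {p : ℕ} (hp : p.Prime)
    (hp0 : (p : R) = 0) (a b : R) : (a + b) ^ p = a ^ p + b ^ p := by
  obtain ⟨r, hr⟩ := exists_add_pow_prime_eq hp a b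
  rw [hr, hp0]; ring

lemma add_pow_add_two_of_pow_three_eq_zero {R : Type*} [CommRing R] {a b h : R}
    (hb : b ^ 3 = 0) (hh : 2 * h = 1) (n : ℕ) :
    (a + b) ^ (n + 2) = a ^ (n + 2) + (n + 2) * a ^ (n + 1) * b +
      h * ((n + 2) * (n + 1)) * a ^ n * b ^ 2 := by
  induction n with
  | zero =>
    simp only [Nat.cast_zero]
    linear_combination -b ^ 2 * hh
  | succ n ih =>
    rw [pow_succ, ih]
    push_cast
    linear_combination (h * ((n + 2) * (n + 1)) * a ^ n) * hb -
      (n + 2) * a ^ (n + 1) * b ^ 2 * hh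

lemma one_add_pow_of_sq_eq_zero {R : Type*} [CommRing R] {u : R} (hu : u ^ 2 = 0) (n : ℕ) :
    (1 + u) ^ n = 1 + n * u := by
  induction n with
  | zero => simp
  | succ n ih =>
    rw [pow_succ, ih]
    push_cast
    linear_combination n * hu

end PowerIdentities

/-! ### Computations in rings where p = 0: elimination of w at the first level. -/

section ModP

variable {p : ℕ} [hp : Fact p.Prime] {B : Type*} [CommRing B] (κ : ℤ_[p] →+* B)

lemma eval₂_pow_card (hp0 : (p : B) = 0) (f : ℤ_[p][X]) (t : B) :
    eval₂ κ t f ^ p = eval₂ κ (t ^ p) f := by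
  obtain ⟨Q, hQ⟩ := exists_pow_eq_expand_add f
  have h := congrArg (eval₂ κ t) hQ
  rw [eval₂_pow, eval₂_add, eval₂_mul, eval₂_C, map_natCast, hp0, zero_mul, add_zero,
    expand_eq_comp_X_pow, eval₂_comp, eval₂_X_pow] at h
  exact h

lemma eval₂_truncExp_succ (n : ℕ) (t : B) :
    eval₂ κ t (truncExp p (n + 1)) = eval₂ κ t (truncExp p n) + κ (invFact p n) * t ^ n := by
  rw [truncExp_succ]; simp

lemma two_mul_invFact_two (hp3 : 3 ≤ p) : 2 * invFact p 2 = 1 := by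
  have := factorial_mul_invFact (p := p) (k := 2) (by omega)
  simpa using this

lemma map_two_mul_invFact_two (hp3 : 3 ≤ p) : 2 * κ (invFact p 2) = 1 := by
  have h := congrArg κ (two_mul_invFact_two (p := p) hp3)
  rw [map_mul, map_one, show (2 : ℤ_[p]) = ((2 : ℕ) : ℤ_[p]) by norm_num, map_natCast] at h
  exact_mod_cast h

/-- The second order Taylor expansion of the truncated exponential. -/
lemma eval₂_truncExp_add (hp3 : 3 ≤ p) {a b : B} (hb : b ^ 3 = 0) {n : ℕ} (hn : n + 2 ≤ p) :
    eval₂ κ (a + b) (truncExp p (n + 2)) = eval₂ κ a (truncExp p (n + 2)) +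
      b * eval₂ κ a (truncExp p (n + 1)) + κ (invFact p 2) * b ^ 2 * eval₂ κ a (truncExp p n) := by
  induction n with
  | zero => simp [truncExp, Finset.sum_range_succ, invFact_zero, invFact_one]; ring
  | succ n ih =>
    have h1 := congrArg κ (succ_mul_invFact_succ (p := p) (k := n + 1) (by omega))
    have h2 := congrArg κ (succ_mul_invFact_succ (p := p) (k := n) (by omega))
    rw [map_mul, map_natCast] at h1 h2
    push_cast at h1 h2
    change eval₂ κ (a + b) (truncExp p (n + 2 + 1)) = eval₂ κ a (truncExp p (n + 2 + 1)) +
      b * eval₂ κ a (truncExp p (n + 1 + 1)) +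
      κ (invFact p 2) * b ^ 2 * eval₂ κ a (truncExp p (n + 1))
    have g0 := eval₂_truncExp_succ κ (p := p) n a
    have g1 := eval₂_truncExp_succ κ (p := p) (n + 1) a
    rw [eval₂_truncExp_succ κ (n + 2) (a + b), eval₂_truncExp_succ κ (n + 2) a, ih (by omega),
      add_pow_add_two_of_pow_three_eq_zero hb (map_two_mul_invFact_two κ hp3) n]
    linear_combination (a ^ (n + 1) * b + κ (invFact p 2) * (n + 1) * a ^ n * b ^ 2) * h1 +
      κ (invFact p 2) * a ^ n * b ^ 2 * h2 - b * g1 - κ (invFact p 2) * b ^ 2 * g0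

lemma map_invFact_pred (hp0 : (p : B) = 0) : κ (invFact p (p - 1)) = -1 := by
  have h1 : (p : ℤ_[p]) ∣ invFact p (p - 1) + 1 := by
    rw [← toZMod_eq_zero_iff, map_add, toZMod_invFact_pred, map_one]; ring
  obtain ⟨d, hd⟩ := h1
  have h2 := congrArg κ hd
  rw [map_add, map_one, map_mul, map_natCast, hp0, zero_mul] at h2
  linear_combination h2

lemma map_invFact_pred_pred (hp0 : (p : B) = 0) : κ (invFact p (p - 2)) = 1 := by
  have h2 := hp.out.two_le
  have h1 := congrArg κ (succ_mul_invFact_succ (p := p) (k := p - 2) (by omega))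
  rw [map_mul, map_natCast, show p - 2 + 1 = p - 1 by omega, map_invFact_pred κ hp0,
    Nat.cast_sub (by omega), hp0] at h1
  rw [← h1]; simp

lemma coeff_truncEin (k : ℕ) : (truncEin p).coeff k =
    if k ∈ Finset.Ico 2 p then (-1) ^ k * invFact p k * Ring.inverse (k : ℤ_[p]) else 0 := by
  simp only [truncEin, finsetSum_coeff, coeff_C_mul, coeff_X_pow, mul_ite, mul_one, mul_zero]
  rw [Finset.sum_ite_eq]

lemma X_sq_dvd_truncEin : (X ^ 2 : ℤ_[p][X]) ∣ truncEin p := by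
  rw [X_pow_dvd_iff]
  intro j hj
  rw [coeff_truncEin, if_neg]
  simp; omega

lemma X_pow_dvd_truncExp_mul_truncEin_sub :
    (X ^ p : ℤ_[p][X]) ∣ truncExp p p * truncEin p -
      ∑ k ∈ Finset.Ico 1 p, C ((k - harmInt p k) * invFact p k) * X ^ k := by
  rw [X_pow_dvd_iff]
  intro j hj
  rw [coeff_sub, finsetSum_coeff]
  simp only [coeff_C_mul, coeff_X_pow, mul_ite, mul_one, mul_zero]
  rw [Finset.sum_ite_eq, mul_comm, coeff_mul,
    Finset.Nat.sum_antidiagonal_eq_sum_range_succ (fun i l => (truncEin p).coeff i *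
      (truncExp p p).coeff l)]
  have h1 : ∑ k ∈ Finset.range j.succ, (truncEin p).coeff k * (truncExp p p).coeff (j - k) =
      ∑ k ∈ Finset.Ico 2 (j + 1), (-1) ^ k * invFact p k * Ring.inverse (k : ℤ_[p]) *
      invFact p (j - k) := by
    symm
    refine Finset.sum_subset_zero_on_sdiff (fun k hk => ?_) (fun k hk => ?_) (fun k hk => ?_)
    · simp at hk ⊢; omega
    · rw [coeff_truncEin, if_neg, zero_mul]
      simp at hk ⊢; omega
    · have := Finset.mem_Ico.1 hk
      rw [coeff_truncEin, if_pos (Finset.mem_Ico.2 ⟨this.1, by omega⟩),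
        coeff_truncExp (by omega)]
  rw [h1]
  rcases Nat.eq_zero_or_pos j with rfl | hj0
  · simp
  · rw [sum_invFact_mul_invFact hj0 hj, if_pos (Finset.mem_Ico.2 ⟨hj0, hj⟩), sub_self]

lemma eval₂_truncExp_mul_truncEin {y : B} (hy : y ^ (2 * p) = 0) :
    y ^ p * (eval₂ κ y (truncExp p p) * eval₂ κ y (truncEin p)) =
      ∑ k ∈ Finset.Ico 1 p, κ ((k - harmInt p k) * invFact p k) * y ^ (p + k) := by
  obtain ⟨M, hM⟩ := X_pow_dvd_truncExp_mul_truncEin_sub (p := p)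
  have h := congrArg (eval₂ κ y) hM
  rw [eval₂_sub, eval₂_mul, eval₂_mul, eval₂_X_pow, eval₂_finsetSum] at h
  simp only [eval₂_mul, eval₂_C, eval₂_X_pow] at h
  simp only [pow_add]
  have h3 : ∑ k ∈ Finset.Ico 1 p, κ ((k - harmInt p k) * invFact p k) * (y ^ p * y ^ k) =
      y ^ p * ∑ k ∈ Finset.Ico 1 p, κ ((k - harmInt p k) * invFact p k) * y ^ k := by
    rw [Finset.mul_sum]; exact Finset.sum_congr rfl fun k _ => by ring
  rw [h3]
  have h4 : y ^ p * y ^ p = 0 := by rw [← pow_add, ← two_mul, hy]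
  linear_combination y ^ p * h + eval₂ κ y M * h4

lemma eval₂_recPolyInt (β : ℤ_[p]) (t : B) : eval₂ κ t (recPolyInt p β) =
    ∑ k ∈ Finset.range p, κ ((-1) ^ k * invFact p k) * t ^ k +
      ∑ k ∈ Finset.Ico 1 p, κ ((-1) ^ k * (β * k - harmInt p k) * invFact p k) * t ^ (p + k) := by
  rw [recPolyInt, eval₂_add, eval₂_finsetSum, eval₂_finsetSum]
  simp only [eval₂_mul, eval₂_C, eval₂_X_pow]

/-- Recognizes R_1 as the polynomial that the Frobenius quotient produces; the minus sign comes from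
(-1)^p = -1. -/
lemma eval₂_recPolyInt_one_neg (hodd : Odd p) {y : B} (hy : y ^ (2 * p) = 0) :
    eval₂ κ (-y) (recPolyInt p 1) = eval₂ κ y (truncExp p p) -
      y ^ p * (eval₂ κ y (truncExp p p) * eval₂ κ y (truncEin p)) := by
  rw [eval₂_truncExp_mul_truncEin κ hy, eval₂_recPolyInt, sub_eq_add_neg, ← Finset.sum_neg_distrib,
    truncExp, eval₂_finsetSum]
  simp only [eval₂_mul, eval₂_C, eval₂_X_pow]
  congr 1
  · refine Finset.sum_congr rfl fun k _ => ?_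
    rw [map_mul, neg_pow y, map_pow, map_neg, map_one]
    have : (-1 : B) ^ k * (-1) ^ k = 1 := by rw [← mul_pow]; simp
    linear_combination κ (invFact p k) * y ^ k * this
  · refine Finset.sum_congr rfl fun k _ => ?_
    have : (-1 : B) ^ k * (-1) ^ k = 1 := by rw [← mul_pow]; simp
    rw [neg_pow y, pow_add (-1 : B), hodd.neg_one_pow, mul_assoc, map_mul κ ((-1) ^ k), map_pow,
      map_neg, map_one, one_mul]
    linear_combination -κ ((k - harmInt p k) * invFact p k) * y ^ (p + k) * this

/-- The congruence for `ζ_{p²}` in terms of `π^{2,1}` (the element `x`). -/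
lemma eq_eval₂_recPolyInt_one (hp3 : 3 ≤ p) (hp0 : (p : B) = 0) {w x z D : B}
    (hw : w ^ (2 * p) = 0) (hD : D = w ^ (p - 1) * x)
    (hz : z = eval₂ κ w (truncExp p p) - D)
    (hx : -x ^ p = w + w ^ p * eval₂ κ w (truncEin p) - z ^ (p - 1) * D +
      κ (invFact p 2) * (z ^ (p - 2) * D ^ 2)) :
    z = eval₂ κ (x ^ p) (recPolyInt p 1) + (x ^ p) ^ (2 * p - 2) * x := by
  have hodd : Odd p := hp.out.odd_of_ne_two (by omega)
  have hh := map_two_mul_invFact_two κ hp3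
  set h := κ (invFact p 2)
  set e := eval₂ κ w (truncExp p p) with he
  set y := -x ^ p with hy
  -- With v = w^{p-3}, powers of w become monomials in w and v, and w^{2p} = 0 reads w^6 v^2 = 0,
  -- usable by `linear_combination`.
  obtain ⟨q, hq⟩ : ∃ q, p = q + 3 := ⟨p - 3, by omega⟩
  set v := w ^ q with hv
  have wp1 : w ^ (p - 1) = w ^ 2 * v := by rw [hv, ← pow_add]; congr 1; omega
  have wp2 : w ^ (p - 2) = w * v := by rw [hv, ← pow_succ']; congr 1; omega
  have wp : w ^ p = w ^ 3 * v := by rw [hv, ← pow_add]; congr 1; omega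
  have hw6 : w ^ 6 * v ^ 2 = 0 := by
    rw [← hw, hv, ← pow_mul, ← pow_add]; congr 1; omega
  -- The exponent 5 + 3(p-3) = 3p - 4 is at least 2p unless p = 3, and then 3 = 0.
  have h3 : 3 * (w ^ 5 * v ^ 3) = 0 := by
    rcases Nat.eq_zero_or_pos q with h0 | h0
    · have : (3 : B) = 0 := by rw [← hp0, hq, h0]; norm_num
      rw [this, zero_mul]
    · have : v = w * w ^ (q - 1) := by rw [hv, ← pow_succ']; congr 1; omega
      linear_combination (3 * w ^ 5 * v ^ 2) * this + 3 * w ^ (q - 1) * hw6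
  obtain ⟨s, hs⟩ : ∃ s, eval₂ κ w (truncEin p) = w ^ 2 * s := by
    obtain ⟨M, hM⟩ := X_sq_dvd_truncEin (p := p)
    exact ⟨eval₂ κ w M, by rw [hM]; simp⟩
  obtain ⟨r, hr⟩ : ∃ r, e = 1 + w + w ^ 2 * r := by
    have hX : X ^ 2 ∣ truncExp p p - 1 - X := by
      rw [X_pow_dvd_iff]
      intro j hj
      rw [coeff_sub, coeff_sub, coeff_truncExp (by omega)]
      interval_cases j <;> simp [invFact_zero, invFact_one, coeff_X, coeff_one]
    obtain ⟨M, hM⟩ := hX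
    refine ⟨eval₂ κ w M, ?_⟩
    have h1 := congrArg (eval₂ κ w) hM
    simp only [eval₂_sub, eval₂_one, eval₂_X, eval₂_mul, eval₂_X_pow] at h1
    rw [he]; linear_combination h1
  rw [wp1] at hD
  rw [wp, hs] at hx
  set Z := z ^ (p - 1) with hZ
  set Z' := z ^ (p - 2) with hZ'
  have hzZ' : z * Z' = Z := by rw [hZ, hZ', ← pow_succ']; congr 1; omega
  have hzZ : z * Z = 1 + w ^ 3 * v := by
    have h1 : z * Z = z ^ p := by rw [hZ, ← pow_succ']; congr 1; omega
    have h2 : D ^ p = 0 := by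
      rw [hq, hD, show (w ^ 2 * v * x) ^ (q + 3) = w ^ 6 * v ^ 2 * (v * x ^ 3 * (w ^ 2 * v * x) ^ q)
        by ring, hw6, zero_mul]
    have h4 : e ^ p = 1 + w ^ p := by
      have h5 : e = 1 + (w + w ^ 2 * r) := by rw [hr]; ring
      have h6 : (w ^ 2 * r) ^ p = 0 := by rw [mul_pow, ← pow_mul, hw, zero_mul]
      rw [h5, add_pow_of_natCast_eq_zero hp.out hp0, add_pow_of_natCast_eq_zero hp.out hp0, h6,
        one_pow, add_zero]
    rw [h1, hz, sub_eq_add_neg, add_pow_of_natCast_eq_zero hp.out hp0, h4, hodd.neg_pow, h2, wp]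
    ring
  -- The displacement H is a multiple of w^{p-1}, so H^3 = 0 and a second order Taylor expansion of
  -- E at w is exact.
  set H := w - y with hH
  set S := w ^ 5 * v * s with hS
  have hHe : H = Z * D - h * (Z' * D ^ 2) - S := by
    rw [hH, hx, hS]; ring
  obtain ⟨g, hg⟩ : ∃ g, H = w ^ 2 * v * g :=
    ⟨Z * x - h * (Z' * (w ^ 2 * v * x ^ 2)) - w ^ 3 * s, by rw [hHe, hD, hS]; ring⟩
  have hH3 : (-H) ^ 3 = 0 := by
    rw [hg]; linear_combination (-v * g ^ 3) * hw6
  have hyw : y = w + -H := by rw [hH]; ring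
  have hp12 : p - 2 + 2 = p := by omega
  have hp11 : p - 2 + 1 = p - 1 := by omega
  have hEy : eval₂ κ y (truncExp p p) = e - H * (e + w ^ 2 * v) +
      h * H ^ 2 * (e + w ^ 2 * v - w * v) := by
    have h1 := eval₂_truncExp_add κ hp3 (a := w) hH3 (n := p - 2) (by omega)
    have h2 := eval₂_truncExp_succ κ (p - 1) w
    have h4 := eval₂_truncExp_succ κ (p - 2) w
    rw [hp12, hp11, ← hyw] at h1
    rw [Nat.sub_add_cancel (by omega), map_invFact_pred κ hp0, ← he, wp1] at h2
    rw [hp11, map_invFact_pred_pred κ hp0, wp2] at h4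
    rw [h1]
    linear_combination (H - h * H ^ 2) * h2 - h * H ^ 2 * h4
  have hy2p : y ^ (2 * p) = 0 := by
    rw [show y = w * (1 - w * v * g) by rw [hyw, hg]; ring, mul_pow, hw, zero_mul]
  have hyS : y ^ p * (eval₂ κ y (truncExp p p) * eval₂ κ y (truncEin p)) = e * S := by
    obtain ⟨M, hM⟩ := X_sq_dvd_truncEin (p := p)
    have h1 : y ^ (p + 2) = w ^ (p + 2) := by
      rw [hyw, add_pow_add_two_of_pow_three_eq_zero hH3 hh, pow_add w p 2,
        pow_succ w p, wp, hp0, hg]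
      linear_combination (-2 * g) * hw6 + (h * 2 * w * v * g ^ 2) * hw6
    have h2 : ∃ t, eval₂ κ y (truncExp p p * M) = eval₂ κ w (truncExp p p * M) + H * t := by
      obtain ⟨t, ht⟩ := sub_dvd_eval_sub y w ((truncExp p p * M).map κ)
      refine ⟨-t, ?_⟩
      rw [eval_map, eval_map] at ht
      rw [hyw] at ht ⊢
      linear_combination ht
    obtain ⟨t, ht⟩ := h2
    have h4 : S = w ^ (p + 2) * eval₂ κ w M := by
      have h5 : w ^ 3 * v * (w ^ 2 * s) = w ^ p * eval₂ κ w (truncEin p) := by rw [wp, hs]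
      rw [hM, eval₂_mul, eval₂_X_pow] at h5
      rw [hS, pow_add]; linear_combination h5
    have h6 : y ^ p * (eval₂ κ y (truncExp p p) * eval₂ κ y (truncEin p)) =
        y ^ (p + 2) * eval₂ κ y (truncExp p p * M) := by
      rw [hM, eval₂_mul, eval₂_mul, eval₂_X_pow, pow_add]; ring
    have h7 : w ^ (p + 2) * H = 0 := by
      rw [pow_add, wp, hg]; linear_combination (w * g) * hw6
    rw [h6, h1, ht, h4, he, eval₂_mul]
    linear_combination t * h7
  have hypow : y ^ (2 * p - 2) = w ^ 4 * v ^ 2 + 2 * (w ^ 3 * v ^ 2 * H) := by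
    have h1 : 2 * p - 2 = 2 * p - 4 + 2 := by omega
    have h2 : w ^ (2 * p - 4) = w ^ 2 * v ^ 2 := by
      rw [hv, ← pow_mul, ← pow_add]; congr 1; omega
    have h4 : ((2 * p - 4 : ℕ) : B) = -4 := by
      rw [Nat.cast_sub (by omega)]; push_cast; rw [hp0]; ring
    rw [hyw, h1, add_pow_add_two_of_pow_three_eq_zero hH3 hh, pow_add w _ 2,
      pow_succ w (2 * p - 4), h2, h4, hg]
    linear_combination (6 * h * v ^ 2 * g ^ 2) * hw6
  have hxp : x ^ p = -y := by rw [hy]; ring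
  have heven : Even (2 * p - 2) := ⟨p - 1, by omega⟩
  have hez : e = z + D := by rw [hz]; ring
  have hzr : z = 1 + w + w ^ 2 * (r - v * x) := by rw [hz, hr, hD]; ring
  rw [hxp, eval₂_recPolyInt_one_neg κ hodd hy2p, hyS, heven.neg_pow, hypow, hEy, hez]
  have hS0 : w ^ 2 * v * S = 0 := by rw [hS]; linear_combination (w * s) * hw6
  have hSS : S ^ 2 = 0 := by rw [hS]; linear_combination (w ^ 4 * s ^ 2) * hw6
  have hDS : D * S = 0 := by rw [hD]; linear_combination x * hS0
  have hD2 : w ^ 2 * v * D ^ 2 = 0 := by rw [hD]; linear_combination (v * x ^ 2) * hw6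
  have hD3 : D ^ 3 = 0 := by rw [hD]; linear_combination (v * x ^ 3) * hw6
  have hwZ : w ^ 4 * v ^ 2 * Z = w ^ 4 * v ^ 2 * (1 - w) := by
    rw [hzr] at hzZ
    linear_combination (w ^ 4 * v ^ 2 * (1 - w)) * hzZ + (Z - (r - v * x) * (1 - w) * Z +
      w * v * (1 - w)) * hw6
  have hHD : H * D = Z * D ^ 2 := by
    rw [hHe]; linear_combination (-h * Z') * hD3 - hDS
  have hHz : H * z = (1 + w ^ 3 * v) * D - h * (Z * D ^ 2) - z * S := by
    rw [hHe, ← hzZ, ← hzZ']; ring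
  have hHw : H * (w ^ 2 * v) = w ^ 4 * v ^ 2 * x - w ^ 5 * v ^ 2 * x := by
    rw [hHe]
    linear_combination (-h * Z') * hD2 - hS0 + x * hwZ + (Z * w ^ 2 * v) * hD
  have hHH : H ^ 2 = Z ^ 2 * D ^ 2 := by
    rw [hHe]
    linear_combination (-2 * Z * h * Z' + h ^ 2 * Z' ^ 2 * D) * hD3 - 2 * Z * hDS +
      2 * h * Z' * D * hDS + hSS
  have hHHz : H ^ 2 * z = Z * D ^ 2 := by
    rw [hHH]; linear_combination (Z * D ^ 2) * hzZ + (Z * w) * hD2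
  have hHHD : H ^ 2 * D = 0 := by rw [hHH]; linear_combination Z ^ 2 * hD3
  have hHHw : H ^ 2 * (w ^ 2 * v) = 0 := by rw [hHH]; linear_combination Z ^ 2 * hD2
  have hw5Z : w ^ 5 * v ^ 3 * Z = w ^ 5 * v ^ 3 := by
    linear_combination (w * v) * hwZ - v * hw6
  have hHHw1 : H ^ 2 * (w * v) = w ^ 5 * v ^ 3 * x ^ 2 := by
    rw [hHH, hD]; linear_combination (Z * x ^ 2 + x ^ 2) * hw5Z
  have hHx : w ^ 3 * v ^ 2 * H * x = w ^ 5 * v ^ 3 * x ^ 2 := by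
    rw [hHe, hD, hS]
    linear_combination x ^ 2 * hw5Z + (-h * Z' * w * v ^ 2 * x ^ 3 - w ^ 2 * v * s * x) * hw6
  have hwD : w ^ 3 * v * D = w ^ 5 * v ^ 2 * x := by rw [hD]; ring
  -- As 3 kills w^5 v^3, 1/2 acts on it as 2. This cancels a second order Taylor term against the
  -- correction in y^{2p-2}.
  have hhalf : h * (w ^ 5 * v ^ 3) = 2 * (w ^ 5 * v ^ 3) := by
    linear_combination (-h) * h3 + 2 * (w ^ 5 * v ^ 3) * hh
  linear_combination hHz + hHD + hHw - h * hHHz - h * hHHD - h * hHHw + h * hHHw1 -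
    2 * hHx + hDS + hwD + x ^ 2 * hhalf - Z * D ^ 2 * hh

end ModP

/-! ### The change of variable from x to u^p modulo x^{2p}. -/

section Recurrence

variable {p : ℕ} [hp : Fact p.Prime] {B : Type*} [CommRing B] (κ : ℤ_[p] →+* B)

/-- Since (t^p)^2 = 0, the k-th power of t + c t^{p+1} is t^k + ck t^{p+k}; the term ck joins βk in
the second sum. -/
lemma eval₂_recPolyInt_add_mul_pow (β c : ℤ_[p]) {t : B} (ht : t ^ (2 * p) = 0) :
    eval₂ κ (t + κ c * t ^ (p + 1)) (recPolyInt p β) = eval₂ κ t (recPolyInt p (β + c)) := by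
  have hpp := hp.out.pos
  have hu : (κ c * t ^ p) ^ 2 = 0 := by rw [mul_pow, ← pow_mul, mul_comm p, ht, mul_zero]
  have hpow : ∀ n : ℕ, (t + κ c * t ^ (p + 1)) ^ n = t ^ n + n * (κ c * (t ^ p * t ^ n)) := by
    intro n
    rw [show t + κ c * t ^ (p + 1) = t * (1 + κ c * t ^ p) by ring, mul_pow,
      one_add_pow_of_sq_eq_zero hu]
    ring
  have htt : t ^ p * t ^ p = 0 := by rw [← pow_add, ← two_mul, ht]
  rw [eval₂_recPolyInt, eval₂_recPolyInt]
  have h2 : ∑ k ∈ Finset.Ico 1 p, κ ((-1) ^ k * (β * k - harmInt p k) * invFact p k) *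
      (t + κ c * t ^ (p + 1)) ^ (p + k) =
      ∑ k ∈ Finset.Ico 1 p, κ ((-1) ^ k * (β * k - harmInt p k) * invFact p k) * t ^ (p + k) := by
    refine Finset.sum_congr rfl fun k _ => ?_
    rw [hpow, pow_add t p k, ← mul_assoc (t ^ p), htt]; simp
  have h1 : ∑ k ∈ Finset.range p, κ ((-1) ^ k * invFact p k) * (t + κ c * t ^ (p + 1)) ^ k =
      ∑ k ∈ Finset.range p, κ ((-1) ^ k * invFact p k) * t ^ k +
      ∑ k ∈ Finset.Ico 1 p, κ ((-1) ^ k * (c * k) * invFact p k) * t ^ (p + k) := by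
    have h3 : ∀ k ∈ Finset.range p, κ ((-1) ^ k * invFact p k) * (t + κ c * t ^ (p + 1)) ^ k =
        κ ((-1) ^ k * invFact p k) * t ^ k +
        κ ((-1) ^ k * (c * k) * invFact p k) * t ^ (p + k) := by
      intro k _
      rw [hpow]
      simp only [map_mul, map_natCast]
      ring
    rw [Finset.sum_congr rfl h3, Finset.sum_add_distrib]
    congr 1
    rw [Finset.range_eq_Ico, Finset.sum_eq_sum_Ico_succ_bot hpp]
    simp
  rw [h1, h2, add_assoc, ← Finset.sum_add_distrib]
  congr 1
  refine Finset.sum_congr rfl fun k _ => ?_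
  simp only [map_mul, map_add, map_sub, map_natCast]
  ring

/-- From v = 1 - x/2 + ... follow v^{2p} = 1 - x^p and v^{2p²} = 1. Hence u^p = (x + (1-c)x^{p+1})(1
- x^p) = x - c x^{p+1}, and (xv)^{2p-2} = x^{2p-2}(1 + x), whose factor 1 + x creates the term
u^{p+1}. -/
lemma recurrence_mod (hp3 : 3 ≤ p) (hp0 : (p : B) = 0) (β c : ℤ_[p]) {x v s u : B}
    (hx : x ^ (2 * p) = 0) (hv : v = 1 - κ (invFact p 2) * x + x ^ 2 * s)
    (hu : u ^ p * v ^ ((2 * p - 2) * p) = x + (1 - κ c) * x ^ (p + 1)) :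
    eval₂ κ x (recPolyInt p β) + (x * v) ^ (2 * p - 2) * u =
      eval₂ κ (u ^ p) (recPolyInt p (β + c)) + (u ^ p) ^ (2 * p - 2) * (u + u ^ (p + 1)) := by
  have hodd : Odd p := hp.out.odd_of_ne_two (by omega)
  have hh := map_two_mul_invFact_two κ hp3
  have hhp : κ (invFact p 2) ^ p = κ (invFact p 2) := by
    simpa using eval₂_pow_card κ hp0 (C (invFact p 2)) 0
  set h := κ (invFact p 2)
  have hxx : x ^ p * x ^ p = 0 := by rw [← pow_add, ← two_mul, hx]
  have hvp : v ^ p = 1 - h * x ^ p := by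
    rw [hv, add_pow_of_natCast_eq_zero hp.out hp0, sub_eq_add_neg,
      add_pow_of_natCast_eq_zero hp.out hp0, hodd.neg_pow, mul_pow, hhp, mul_pow, ← pow_mul, hx]
    ring
  have hv2p : v ^ (2 * p) = 1 - x ^ p := by
    rw [mul_comm, pow_mul, hvp]
    linear_combination (-x ^ p) * hh + h ^ 2 * hxx
  have hvpp : v ^ (2 * p * p) = 1 := by
    have h1 : (x ^ p) ^ p = 0 := by
      rw [← pow_mul, show p * p = 2 * p + (p - 2) * p by
        rw [← add_mul]; congr 1; omega, pow_add, hx, zero_mul]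
    rw [pow_mul, hv2p, sub_eq_add_neg, add_pow_of_natCast_eq_zero hp.out hp0, hodd.neg_pow, h1]
    simp
  have ht : u ^ p = x - κ c * x ^ (p + 1) := by
    have h1 : v ^ (2 * p * p) = v ^ ((2 * p - 2) * p) * v ^ (2 * p) := by
      rw [← pow_add]; congr 1; rw [← add_mul]; congr 1; omega
    rw [hvpp] at h1
    rw [hv2p] at h1
    linear_combination (u ^ p) * h1 + (1 - x ^ p) * hu - (1 - κ c) * x * hxx
  set t := u ^ p with htu
  have ht2p : t ^ (2 * p) = 0 := by
    rw [ht, show x - κ c * x ^ (p + 1) = x * (1 - κ c * x ^ p) by ring, mul_pow, hx, zero_mul]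
  have htt : t ^ p * t ^ p = 0 := by rw [← pow_add, ← two_mul, ht2p]
  have hxt : x = t + κ c * t ^ (p + 1) := by
    have h1 : t ^ (p + 1) = x ^ (p + 1) := by
      have h2 : (-(κ c * x ^ p)) ^ 2 = 0 := by linear_combination κ c ^ 2 * hxx
      rw [ht, show x - κ c * x ^ (p + 1) = x * (1 + -(κ c * x ^ p)) by ring, mul_pow,
        one_add_pow_of_sq_eq_zero h2]
      linear_combination (-(p + 1 : ℕ) * κ c * x) * hxx
    rw [h1, ht]; ring
  have hxv : x ^ (2 * p - 2) * v ^ (2 * p - 2) = x ^ (2 * p - 2) * (1 + x) := by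
    have h1 : v ^ (2 * p - 2) * v ^ 2 = 1 - x ^ p := by
      rw [← hv2p, ← pow_add]; congr 1; omega
    have h2 : x ^ (2 * p - 2) * x ^ 2 = 0 := by
      rw [← hx, ← pow_add]; congr 1; omega
    have h3 : x ^ (2 * p - 2) * x ^ p = 0 := by
      rw [← pow_add, show 2 * p - 2 + p = 2 * p + (p - 2) by omega, pow_add, hx, zero_mul]
    have h4 : x ^ (2 * p - 2) * v ^ 2 = x ^ (2 * p - 2) * (1 - x) := by
      rw [hv]
      linear_combination (2 * s * (1 - h * x) + x ^ 2 * s ^ 2 + h ^ 2) * h2 -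
        x ^ (2 * p - 2) * x * hh
    generalize v ^ (2 * p - 2) = V at *
    linear_combination (-V * (1 + x)) * h4 + x ^ (2 * p - 2) * (1 + x) * h1 + V * h2 -
      (1 + x) * h3
  have hxt' : x ^ (2 * p - 2) * (1 + x) = t ^ (2 * p - 2) * (1 + t) := by
    have h1 : (κ c * t ^ p) ^ 2 = 0 := by linear_combination κ c ^ 2 * htt
    have h2 : t ^ (2 * p - 2) * t ^ p = 0 := by
      rw [← pow_add, show 2 * p - 2 + p = 2 * p + (p - 2) by omega, pow_add, ht2p, zero_mul]
    have h3 : x ^ (2 * p - 2) = t ^ (2 * p - 2) := by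
      rw [hxt, show t + κ c * t ^ (p + 1) = t * (1 + κ c * t ^ p) by ring, mul_pow,
        one_add_pow_of_sq_eq_zero h1]
      linear_combination ((2 * p - 2 : ℕ) * κ c) * h2
    rw [h3]
    nth_rewrite 1 [hxt]
    linear_combination κ c * t * h2
  rw [← eval₂_recPolyInt_add_mul_pow κ β c ht2p, ← hxt, mul_pow, hxv, hxt', pow_succ, ← htu]
  ring

end Recurrence

/-! ### From one level to the next in an integrally closed local domain. -/

section LevelStep

variable {p : ℕ} [hp : Fact p.Prime] {O : Type*} [CommRing O]

/-- `z` is given by the recurrence polynomial `recPolyInt p β` at `x ^ p` up to an explicit error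
term, modulo `x ^ (2 * p ^ 2)`. -/
structure LevelCongruence (ι : ℤ_[p] →+* O) (β c : ℤ_[p]) (z x : O) : Prop where
  ne_zero : x ≠ 0
  not_isUnit : ¬ IsUnit x
  dvd_natCast : (x ^ p) ^ (2 * p) ∣ (p : O)
  dvd_sub : (x ^ p) ^ (2 * p) ∣ z - (eval₂ ι (x ^ p) (recPolyInt p β) +
    (x ^ p) ^ (2 * p - 2) * (x + (1 - ι c) * x ^ (p + 1)))

omit hp in
lemma natCast_quotient_eq_zero {a : O} (h : a ∣ (p : O)) :
    ((p : ℕ) : O ⧸ Ideal.span {a}) = 0 := by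
  rw [← map_natCast (Ideal.Quotient.mk (Ideal.span {a})), Ideal.Quotient.eq_zero_iff_mem,
    Ideal.mem_span_singleton]
  exact h

lemma mk_self_eq_zero (a : O) : Ideal.Quotient.mk (Ideal.span {a}) a = 0 := by
  rw [Ideal.Quotient.eq_zero_iff_mem]; exact Ideal.mem_span_singleton_self a

/-- These terms give z' - 1 = -x(1 - x/2 + O(x^2)), the precision that `recurrence_mod` needs. -/
lemma X_pow_three_dvd_recPolyInt_sub (hp3 : 3 ≤ p) (β : ℤ_[p]) :
    X ^ 3 ∣ recPolyInt p β - (1 - X + C (invFact p 2) * X ^ 2) := by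
  have h1 : X ^ 3 ∣ ∑ k ∈ Finset.Ico 1 p,
      C ((-1) ^ k * (β * k - harmInt p k) * invFact p k) * X ^ (p + k) := by
    refine Finset.dvd_sum fun k hk => Dvd.dvd.mul_left (pow_dvd_pow _ ?_) _
    omega
  have h2 : X ^ 3 ∣ ∑ k ∈ Finset.Ico 3 p, C ((-1) ^ k * invFact p k) * X ^ k := by
    refine Finset.dvd_sum fun k hk => Dvd.dvd.mul_left (pow_dvd_pow _ ?_) _
    exact (Finset.mem_Ico.1 hk).1
  have h3 : recPolyInt p β - (1 - X + C (invFact p 2) * X ^ 2) =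
      ∑ k ∈ Finset.Ico 3 p, C ((-1) ^ k * invFact p k) * X ^ k + ∑ k ∈ Finset.Ico 1 p,
      C ((-1) ^ k * (β * k - harmInt p k) * invFact p k) * X ^ (p + k) := by
    rw [recPolyInt, Finset.range_eq_Ico, Finset.sum_eq_sum_Ico_succ_bot (by omega),
      Finset.sum_eq_sum_Ico_succ_bot (by omega), Finset.sum_eq_sum_Ico_succ_bot (by omega)]
    simp [invFact_zero, invFact_one]
    ring
  rw [h3]
  exact dvd_add h2 h1

variable [IsLocalRing O]

lemma isUnit_one_add {x : O} (hx : ¬ IsUnit x) : IsUnit (1 + x) := by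
  by_contra h
  have h1 : x ∈ IsLocalRing.maximalIdeal O := hx
  have h2 : (1 + x) ∈ IsLocalRing.maximalIdeal O := h
  exact (Ideal.add_mem_iff_left _ h1).1 h2 isUnit_one

lemma isUnit_one_add_mul {x : O} (hx : ¬ IsUnit x) (a : O) : IsUnit (1 + x * a) :=
  isUnit_one_add fun h => hx (isUnit_of_mul_isUnit_left h)

variable [IsDomain O] [IsIntegrallyClosed O]

/-- Passage from one level of the recurrence to the next. -/
theorem LevelCongruence.step {ι : ℤ_[p] →+* O} {β c : ℤ_[p]} {z x z' : O} (hp3 : 3 ≤ p)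
    (H : LevelCongruence ι β c z x) (hz' : z' ^ p = z) :
    ∃ u, z' - eval₂ ι x (recPolyInt p β) = (z' - 1) ^ (2 * p - 2) * u ∧ z' - 1 ≠ 0 ∧
      Associated (u ^ p) x ∧ LevelCongruence ι (β + c) 0 z' u := by
  have hpp := hp.out.pos
  obtain ⟨P, hP⟩ := H.dvd_natCast
  obtain ⟨r₁, hr₁⟩ := H.dvd_sub
  set R := recPolyInt p β with hR
  set E := eval₂ ι x R with hE
  set D := z' - E with hD
  have hx0 := H.ne_zero
  have hsplit : (x ^ p) ^ (2 * p) = (x ^ (2 * p - 2)) ^ p * x ^ (2 * p) := by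
    rw [← pow_mul, ← pow_mul, ← pow_add]; congr 1
    obtain ⟨q, rfl⟩ : ∃ q, p = q + 2 := ⟨p - 2, by omega⟩
    rw [show 2 * (q + 2) - 2 = 2 * q + 2 by omega]; ring
  have hswap : (x ^ p) ^ (2 * p - 2) = (x ^ (2 * p - 2)) ^ p := by
    rw [← pow_mul, ← pow_mul, mul_comm]
  -- Expand z = (E + D)^p and use E^p = R(x^p) + p(...); every multiple of p is absorbed in r, since
  -- x^{2p²} divides p.
  have hDp : ∃ r, D ^ p = (x ^ (2 * p - 2)) ^ p * (x + (1 - ι c) * x ^ (p + 1) + x ^ (2 * p) * r) := by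
    obtain ⟨Q, hQ⟩ := exists_pow_eq_expand_add R
    have h1 := congrArg (eval₂ ι x) hQ
    rw [eval₂_pow, eval₂_add, eval₂_mul, eval₂_C, map_natCast, expand_eq_comp_X_pow, eval₂_comp,
      eval₂_X_pow, ← hE] at h1
    obtain ⟨r₂, hr₂⟩ := exists_add_pow_prime_eq hp.out E D
    rw [show E + D = z' by rw [hD]; ring, hz'] at hr₂
    refine ⟨r₁ - P * eval₂ ι x Q - P * (E * D * r₂), ?_⟩
    rw [hswap] at hr₁
    rw [hsplit] at hr₁ hP
    linear_combination hr₁ - hr₂ - h1 - (eval₂ ι x Q + E * D * r₂) * hP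
  obtain ⟨r, hr⟩ := hDp
  obtain ⟨d, hd⟩ : x ^ (2 * p - 2) ∣ D :=
    (IsIntegrallyClosed.pow_dvd_pow_iff hpp.ne').1 ⟨_, hr⟩
  have hdp : d ^ p = x + (1 - ι c) * x ^ (p + 1) + x ^ (2 * p) * r := by
    rw [hd, mul_pow] at hr
    exact mul_left_cancel₀ (pow_ne_zero _ (pow_ne_zero _ hx0)) hr
  obtain ⟨M, hM⟩ := X_pow_three_dvd_recPolyInt_sub hp3 β
  have hE' : E = 1 - x + ι (invFact p 2) * x ^ 2 + x ^ 3 * eval₂ ι x M := by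
    have h1 := congrArg (eval₂ ι x) hM
    simp only [eval₂_sub, eval₂_add, eval₂_one, eval₂_X, eval₂_mul, eval₂_X_pow, eval₂_C] at h1
    rw [hE]; linear_combination h1
  set h := ι (invFact p 2)
  set s := -(eval₂ ι x M + x ^ (2 * p - 5) * d) with hs
  set v := 1 - h * x + x ^ 2 * s with hv
  have hz1 : z' - 1 = -(x * v) := by
    have h1 : x ^ (2 * p - 2) = x ^ 3 * x ^ (2 * p - 5) := by
      rw [← pow_add]; congr 1; omega
    rw [h1] at hd
    rw [hv, hs, show z' = E + D by rw [hD]; ring, hd, hE']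
    ring
  have hvu : IsUnit v := by
    have := isUnit_one_add_mul H.not_isUnit (-h + x * s)
    rwa [show 1 + x * (-h + x * s) = v by rw [hv]; ring] at this
  obtain ⟨v', hv'⟩ := hvu.exists_right_inv
  set u := v' ^ (2 * p - 2) * d with hu
  have hdu : d = v ^ (2 * p - 2) * u := by
    rw [hu, ← mul_assoc, ← mul_pow, hv', one_pow, one_mul]
  have heven : Even (2 * p - 2) := ⟨p - 1, by omega⟩
  have hup : u ^ p * v ^ ((2 * p - 2) * p) = x + (1 - ι c) * x ^ (p + 1) + x ^ (2 * p) * r := by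
    rw [← hdp, hdu, mul_pow, ← pow_mul]; ring
  have hDu : D = (x * v) ^ (2 * p - 2) * u := by
    rw [hd, hdu, mul_pow]; ring
  have hass : Associated (u ^ p) x := by
    have hx1 : x ^ (2 * p) = x * (x * x ^ (2 * p - 2)) := by
      rw [← pow_succ', ← pow_succ']; congr 1; omega
    have hx2 : x ^ (p + 1) = x * (x * x ^ (p - 1)) := by
      rw [← pow_succ', ← pow_succ']; congr 1; omega
    have hun := isUnit_one_add_mul H.not_isUnit ((1 - ι c) * x ^ (p - 1) + x ^ (2 * p - 2) * r)
    have h1 : Associated (u ^ p * v ^ ((2 * p - 2) * p)) (u ^ p) :=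
      associated_mul_unit_left _ _ (hvu.pow _)
    refine h1.symm.trans ?_
    rw [hup, hx1, hx2, show x + (1 - ι c) * (x * (x * x ^ (p - 1))) +
      x * (x * x ^ (2 * p - 2)) * r = x * (1 + x * ((1 - ι c) * x ^ (p - 1) + x ^ (2 * p - 2) * r))
      by ring]
    exact associated_mul_unit_left _ _ hun
  -- The new modulus generates the ideal (x^{2p}), so the new congruence can be checked in the
  -- quotient by it, where p = 0.
  have hass2 : Associated ((u ^ p) ^ (2 * p)) (x ^ (2 * p)) := hass.pow_pow
  have hxdvd : x ^ (2 * p) ∣ (p : O) := by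
    rw [hP, hsplit]
    exact Dvd.dvd.mul_right (Dvd.dvd.mul_left dvd_rfl _) _
  refine ⟨u, ?_, ?_, hass, ⟨?_, ?_, ?_, ?_⟩⟩
  · rw [hz1, heven.neg_pow, hDu]
  · rw [hz1]
    exact neg_ne_zero.2 (mul_ne_zero hx0 hvu.ne_zero)
  · rintro h0
    rw [h0, zero_pow hpp.ne'] at hass
    exact hx0 (associated_zero_iff_eq_zero _ |>.1 hass.symm)
  · intro hu'
    exact H.not_isUnit (hass.isUnit (hu'.pow p))
  · exact hass2.dvd.trans hxdvd
  · refine hass2.dvd.trans ?_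
    rw [← Ideal.mem_span_singleton, ← Ideal.Quotient.eq_zero_iff_mem]
    have hp0 := natCast_quotient_eq_zero hxdvd
    have hx00 := mk_self_eq_zero (x ^ (2 * p))
    set π := Ideal.Quotient.mk (Ideal.span {x ^ (2 * p)}) with hπ
    have key := recurrence_mod (π.comp ι) hp3 hp0 β c (x := π x) (v := π v) (s := π s) (u := π u)
      (by rw [← map_pow]; exact hx00)
      (by rw [hv]; simp [h])
      (by
        have := congrArg π hup
        rw [map_add, map_mul π (x ^ (2 * p)), hx00] at this
        simpa using this)
    rw [map_zero, sub_zero, one_mul, show z' = E + (x * v) ^ (2 * p - 2) * u by rw [← hDu, hD]; ring,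
      map_sub, sub_eq_zero]
    simp only [map_add, map_mul, map_pow, hE, hom_eval₂, hR]
    exact key

end LevelStep

/-! ### The congruence for ζ_{p²}. -/

section InitialLevel

variable {p : ℕ} [hp : Fact p.Prime] {O : Type*} [CommRing O]

lemma exists_eval₂_eq_one_add {F : ℤ_[p][X]} (hF0 : F.coeff 0 = 1) (hF1 : F.coeff 1 = 1)
    (ι : ℤ_[p] →+* O) (t : O) : ∃ a, eval₂ ι t F = 1 + t + t ^ 2 * a := by
  have hX : X ^ 2 ∣ F - 1 - X := by
    rw [X_pow_dvd_iff]
    intro j hj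
    rw [coeff_sub, coeff_sub]
    interval_cases j <;> simp [hF0, hF1, coeff_X, coeff_one]
  obtain ⟨M, hM⟩ := hX
  refine ⟨eval₂ ι t M, ?_⟩
  have h1 := congrArg (eval₂ ι t) hM
  simp only [eval₂_sub, eval₂_one, eval₂_X, eval₂_mul, eval₂_X_pow] at h1
  linear_combination h1

lemma eval₂_frobenius_quotient {Q M N : ℤ_[p][X]} {c : ℤ_[p]}
    (hQ : Q = X + C c * X ^ p + X ^ p * truncEin p + X ^ (2 * p) * M + C (p : ℤ_[p]) * X ^ 2 * N)
    (ι : ℤ_[p] →+* O) (t : O) : eval₂ ι t Q = t + ι c * t ^ p + t ^ p * eval₂ ι t (truncEin p) +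
      t ^ (2 * p) * eval₂ ι t M + p * t ^ 2 * eval₂ ι t N := by
  rw [hQ]
  simp only [eval₂_add, eval₂_mul, eval₂_X, eval₂_C, eval₂_X_pow, eval₂_natCast, map_natCast]

lemma eval₂_pow_eq_of_pow_eq_expand_add {F Q : ℤ_[p][X]}
    (h : F ^ p = expand ℤ_[p] p F + C (p : ℤ_[p]) * Q) (ι : ℤ_[p] →+* O) (t : O) :
    eval₂ ι t F ^ p = eval₂ ι (t ^ p) F + p * eval₂ ι t Q := by
  have h1 := congrArg (eval₂ ι t) h
  rwa [eval₂_pow, eval₂_add, eval₂_mul, eval₂_C, map_natCast, expand_eq_comp_X_pow, eval₂_comp,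
    eval₂_X_pow] at h1

variable [IsLocalRing O]

lemma not_isUnit_add {a b : O} (ha : ¬ IsUnit a) (hb : ¬ IsUnit b) : ¬ IsUnit (a + b) :=
  IsLocalRing.nonunits_add ha hb

omit [IsLocalRing O] in
lemma not_isUnit_mul {a : O} (ha : ¬ IsUnit a) (b : O) : ¬ IsUnit (a * b) :=
  fun h => ha (isUnit_of_mul_isUnit_left h)

variable [IsDomain O]

/-- The expansion of a primitive `p`-th root of unity in terms of a `(p - 1)`-th root of `-p`. -/
lemma eval₂_sub_pth_root_of_unity (hp3 : 3 ≤ p) {F Q M N : ℤ_[p][X]} {c : ℤ_[p]}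
    (hF0 : F.coeff 0 = 1) (hF1 : F.coeff 1 = 1)
    (hFQ : F ^ p = expand ℤ_[p] p F + C (p : ℤ_[p]) * Q)
    (hQ : Q = X + C c * X ^ p + X ^ p * truncEin p + X ^ (2 * p) * M + C (p : ℤ_[p]) * X ^ 2 * N)
    (ι : ℤ_[p] →+* O) {ϖ ζ e : O} (hϖ0 : ϖ ≠ 0) (hϖ : ¬ IsUnit ϖ)
    (hpϖ : (p : O) = -ϖ ^ (p - 1)) (hζ : ζ ^ p = 1) (he : eval₂ ι ϖ F - ζ = ϖ * e)
    (he' : ¬ IsUnit e) : ∃ t, eval₂ ι ϖ F - ζ = -p * (ι c * ϖ + ϖ ^ 2 * t) := by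
  obtain ⟨T, hT⟩ := X_sq_dvd_truncEin (p := p)
  obtain ⟨a, ha⟩ := exists_eval₂_eq_one_add hF0 hF1 ι (ϖ ^ p)
  obtain ⟨a', ha'⟩ := exists_eval₂_eq_one_add hF0 hF1 ι ϖ
  have h1 := eval₂_pow_eq_of_pow_eq_expand_add hFQ ι ϖ
  have hQϖ := eval₂_frobenius_quotient hQ ι ϖ
  rw [hT, eval₂_mul, eval₂_X_pow] at hQϖ
  obtain ⟨r, hr⟩ := exists_add_pow_prime_eq_of_odd hp.out hp3 ζ (ϖ * e)
  rw [show ζ + ϖ * e = eval₂ ι ϖ F by rw [← he]; ring, h1, hζ, ha, hQϖ] at hr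
  set m : O := (((p - 1) / 2 : ℕ) : O)
  set V := ϖ ^ (p - 1) with hV
  have hVp : ϖ ^ p = V * ϖ := by rw [hV, ← pow_succ, Nat.sub_add_cancel hp.out.one_le]
  have hep : e ^ p = e ^ (p - 1) * e := by rw [← pow_succ, Nat.sub_add_cancel hp.out.one_le]
  have hV0 : V ≠ 0 := pow_ne_zero _ hϖ0
  set U := ζ ^ (p - 1) + m * (ζ ^ (p - 2) * ϖ * e) + ϖ ^ 2 * e ^ 2 * r - e ^ (p - 1) with hU
  set b := ϖ * eval₂ ι ϖ T + V * eval₂ ι ϖ M - eval₂ ι ϖ N with hb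
  -- The terms ϖ^p of F(ϖ^p) and pϖ of pQ(ϖ) cancel because p = -ϖ^{p-1}. The rest, divided by ϖ^p,
  -- is a linear-looking equation for e whose factor U is 1 modulo the maximal ideal.
  have hmain : e * U = V * (ι c + ϖ * (b - a)) := by
    have h2p : ϖ ^ (2 * p) = (V * ϖ) ^ 2 := by rw [← hVp, ← pow_mul, mul_comm]
    rw [mul_pow ϖ e p, h2p, hVp, hpϖ, hep] at hr
    refine mul_left_cancel₀ (mul_ne_zero hV0 hϖ0) ?_
    rw [hU, hb]
    linear_combination hr
  have hζ1 : ζ = 1 + ϖ * (1 + ϖ * a' - e) := by linear_combination ha' - he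
  obtain ⟨g, hg⟩ : ∃ g, ζ ^ (p - 1) = 1 + ϖ * g := by
    have h2 := sub_dvd_pow_sub_pow ζ 1 (p - 1)
    rw [one_pow] at h2
    obtain ⟨k, hk⟩ := h2
    exact ⟨(1 + ϖ * a' - e) * k, by linear_combination hk + k * hζ1⟩
  have heu : e ^ (p - 1) = e * e ^ (p - 2) := by rw [← pow_succ']; congr 1; omega
  have hUu : IsUnit U := by
    rw [show U = 1 + (ϖ * (g + m * (ζ ^ (p - 2) * e) + ϖ * e ^ 2 * r) + e * (-e ^ (p - 2))) by
      rw [hU, hg, heu]; ring]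
    exact isUnit_one_add (not_isUnit_add (not_isUnit_mul hϖ _) (not_isUnit_mul he' _))
  obtain ⟨U', hU'⟩ := hUu.exists_right_inv
  set f := U' * (ι c + ϖ * (b - a)) with hf
  have hef : e = V * f := by
    rw [hf]; linear_combination U' * hmain - e * hU'
  have hfU : f * U = ι c + ϖ * (b - a) := by rw [hf]; linear_combination (ι c + ϖ * (b - a)) * hU'
  have hVϖ : V = ϖ * ϖ ^ (p - 2) := by rw [hV, ← pow_succ']; congr 1; omega
  refine ⟨b - a - f * (g + m * (ζ ^ (p - 2) * e) + ϖ * e ^ 2 * r -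
    ϖ ^ (p - 2) * f * e ^ (p - 2)), ?_⟩
  -- Bootstrapping: e is now known to be a multiple of V = ϖ^{p-1}, which improves U to 1 modulo ϖ.
  have hU2 : U = 1 + ϖ * (g + m * (ζ ^ (p - 2) * e) + ϖ * e ^ 2 * r -
      ϖ ^ (p - 2) * f * e ^ (p - 2)) := by
    rw [hU, hg, heu]
    linear_combination (-e ^ (p - 2)) * hef - f * e ^ (p - 2) * hVϖ
  rw [he, hpϖ]
  linear_combination ϖ * hef + V * ϖ * hfU - V * ϖ * f * hU2

variable [IsIntegrallyClosed O]

/-- The first level of the recurrence, given the expansion of the `p`-th root of unity. -/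
lemma levelCongruence_of_pth_root (hp3 : 3 ≤ p) {F Q M N : ℤ_[p][X]} {c : ℤ_[p]}
    (hF : F.map PadicInt.toZMod = truncExpMod p)
    (hFQ : F ^ p = expand ℤ_[p] p F + C (p : ℤ_[p]) * Q)
    (hQ : Q = X + C c * X ^ p + X ^ p * truncEin p + X ^ (2 * p) * M + C (p : ℤ_[p]) * X ^ 2 * N)
    (ι : ℤ_[p] →+* O) {w z t : O} (hw0 : w ≠ 0) (hw : ¬ IsUnit w)
    (hpw : (p : O) = -w ^ (p * (p - 1)))
    (hz : eval₂ ι (w ^ p) F - z ^ p = -p * (ι c * w ^ p + (w ^ p) ^ 2 * t)) :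
    ∃ x, eval₂ ι w F - z = w ^ (p - 1) * x ∧ Associated (x ^ p) w ∧
      LevelCongruence ι 1 1 z x := by
  have hpp := hp.out.pos
  have h1 := eval₂_pow_eq_of_pow_eq_expand_add hFQ ι w
  have hQw := eval₂_frobenius_quotient hQ ι w
  set f := eval₂ ι w F with hf
  set D := f - z with hD
  obtain ⟨r, hr⟩ := exists_add_pow_prime_eq_of_odd hp.out hp3 z D
  rw [show z + D = f by rw [hD]; ring] at hr
  set m : O := (((p - 1) / 2 : ℕ) : O) with hm
  have hw2 : (w ^ p) ^ 2 = w ^ (2 * p) := by rw [← pow_mul, mul_comm]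
  set S := eval₂ ι w (truncEin p) with hS
  set G := eval₂ ι w M - t - w ^ (p * (p - 3)) * w ^ 2 * eval₂ ι w N with hG
  have hpw' : w ^ (p * (p - 1)) = w ^ (2 * p) * w ^ (p * (p - 3)) := by
    rw [← pow_add]; congr 1
    obtain ⟨q, rfl⟩ : ∃ q, p = q + 3 := ⟨p - 3, by omega⟩
    rw [show q + 3 - 1 = q + 2 by omega, show q + 3 - 3 = q by omega]; ring
  -- The unknown term c w^p of Q(w) cancels against the one in the expansion of z^p.
  have hDp : D ^ p = p * (w + w ^ p * S + w ^ (2 * p) * G - z ^ (p - 1) * D -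
      m * (z ^ (p - 2) * D ^ 2) - D ^ 3 * r) := by
    rw [hG]
    rw [hw2] at hz
    linear_combination h1 + (p : O) * hQw - hr + hz + p * w ^ 2 * eval₂ ι w N * hpw -
      p * w ^ 2 * eval₂ ι w N * hpw'
  have hpw2 : (p : O) = -(w ^ (p - 1)) ^ p := by rw [hpw, ← pow_mul, mul_comm p]
  obtain ⟨x, hx⟩ : w ^ (p - 1) ∣ D := by
    refine (IsIntegrallyClosed.pow_dvd_pow_iff hpp.ne').1 ?_
    rw [hDp, hpw2]
    exact Dvd.dvd.mul_right ((dvd_neg).2 dvd_rfl) _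
  have hp0 : (p : O) ≠ 0 := by
    rw [hpw2]; exact neg_ne_zero.2 (pow_ne_zero _ (pow_ne_zero _ hw0))
  have hxp : -x ^ p = w + w ^ p * S + w ^ (2 * p) * G - z ^ (p - 1) * D -
      m * (z ^ (p - 2) * D ^ 2) - D ^ 3 * r := by
    refine mul_left_cancel₀ hp0 ?_
    rw [← hDp, hx, mul_pow]
    linear_combination (-x ^ p) * hpw2
  have hass : Associated (x ^ p) w := by
    have e1 : w ^ p = w * (w * w ^ (p - 2)) := by
      rw [← pow_succ', ← pow_succ']; congr 1; omega
    have e2 : w ^ (2 * p) = w * (w * w ^ (2 * p - 2)) := by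
      rw [← pow_succ', ← pow_succ']; congr 1; omega
    have e3 : D = w * (w * (w ^ (p - 3) * x)) := by
      rw [hx, ← mul_assoc, ← mul_assoc, mul_assoc w w, ← pow_succ', ← pow_succ']
      congr 2; omega
    have hun := isUnit_one_add_mul hw (w ^ (p - 2) * S + w ^ (2 * p - 2) * G -
      z ^ (p - 1) * (w ^ (p - 3) * x) - m * (z ^ (p - 2) * (w ^ (p - 3) * x) * D) -
      (w ^ (p - 3) * x) * D ^ 2 * r)
    obtain ⟨k, hk⟩ := hun.neg
    refine Associated.symm ⟨k, ?_⟩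
    rw [hk]
    have e4 : D ^ 2 = w * (w * (w ^ (p - 3) * x)) * D := by rw [← e3]; ring
    have e5 : D ^ 3 = w * (w * (w ^ (p - 3) * x)) * D ^ 2 := by rw [← e3]; ring
    rw [e1, e2] at hxp
    linear_combination hxp - z ^ (p - 1) * e3 - m * z ^ (p - 2) * e4 - r * e5
  have hass2 : Associated ((x ^ p) ^ (2 * p)) (w ^ (2 * p)) := hass.pow_pow
  have hwdvd : w ^ (2 * p) ∣ (p : O) := by
    rw [hpw, hpw']
    exact (dvd_neg).2 (dvd_mul_right _ _)
  refine ⟨x, hx, hass, ⟨?_, ?_, ?_, ?_⟩⟩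
  · rintro h0
    rw [h0, zero_pow hpp.ne'] at hass
    exact hw0 (associated_zero_iff_eq_zero _ |>.1 hass.symm)
  · intro hu'
    exact hw (hass.isUnit (hu'.pow p))
  · exact hass2.dvd.trans hwdvd
  · refine hass2.dvd.trans ?_
    rw [← Ideal.mem_span_singleton, ← Ideal.Quotient.eq_zero_iff_mem]
    have hp00 := natCast_quotient_eq_zero hwdvd
    have hw00 := mk_self_eq_zero (w ^ (2 * p))
    set π := Ideal.Quotient.mk (Ideal.span {w ^ (2 * p)}) with hπ
    have hfE : π f = eval₂ (π.comp ι) (π w) (truncExp p p) := by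
      have h2 : C (p : ℤ_[p]) ∣ F - truncExp p p := by
        rw [C_dvd_iff_dvd_coeff]
        intro j
        rw [← toZMod_eq_zero_iff, ← coeff_map, Polynomial.map_sub, hF, truncExpMod, sub_self,
          coeff_zero]
      obtain ⟨L, hL⟩ := h2
      have h3 := congrArg (eval₂ (π.comp ι) (π w)) hL
      rw [eval₂_sub, eval₂_mul, eval₂_C, map_natCast, hp00, zero_mul, sub_eq_zero] at h3
      rw [hf, hom_eval₂, h3]
    have hh := map_two_mul_invFact_two (π.comp ι) hp3
    have hm2 : π m = -(π.comp ι) (invFact p 2) := by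
      have h2 : (2 : O) * m = p - 1 := by
        have h3 : 2 * ((p - 1) / 2) = p - 1 :=
          Nat.mul_div_cancel' (hp.out.even_sub_one (by omega)).two_dvd
        have h4 := congrArg (Nat.cast : ℕ → O) h3
        rw [Nat.cast_mul, Nat.cast_sub hp.out.one_le, Nat.cast_one, Nat.cast_ofNat] at h4
        exact h4
      have h5 := congrArg π h2
      have hπp : π (p : O) = 0 := by rw [map_natCast]; exact hp00
      rw [map_mul, map_sub, map_one, hπp, map_ofNat] at h5
      linear_combination (π.comp ι) (invFact p 2) * h5 - π m * hh
    have hD3 : π D ^ 3 = 0 := by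
      rw [← map_pow, hx, mul_pow, ← pow_mul,
        show (p - 1) * 3 = 2 * p + (p - 3) by omega, pow_add, mul_assoc, map_mul, hw00, zero_mul]
    have key := eq_eval₂_recPolyInt_one (π.comp ι) hp3 hp00 (w := π w) (x := π x) (z := π z)
      (D := π D) (by rw [← map_pow]; exact hw00) (by rw [hx]; simp)
      (by rw [← hfE, hD]; simp)
      (by
        have h2 := congrArg π hxp
        simp only [map_add, map_sub, map_mul, map_neg, map_pow π D 3, hD3, hw00, hm2] at h2
        rw [hS, hom_eval₂] at h2
        simp only [map_pow] at h2 ⊢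
        linear_combination h2)
    rw [map_one, sub_self, zero_mul, add_zero, map_sub, sub_eq_zero, map_add, hom_eval₂, map_mul,
      map_pow, map_pow]
    exact key

/-- The first level of the recurrence. -/
theorem levelCongruence_initial (hp3 : 3 ≤ p) (ι : ℤ_[p] →+* O) {w z ε : O} (hw0 : w ≠ 0)
    (hw : ¬ IsUnit w) (hpw : (p : O) = -w ^ (p * (p - 1))) (hz : z = 1 + w + w * ε)
    (hε : ¬ IsUnit ε) (hz1 : (z ^ p) ^ p = 1) :
    ∃ x, eval₂ ι w (teichExp p) - z = w ^ (p - 1) * x ∧ Associated (x ^ p) w ∧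
      LevelCongruence ι 1 1 z x := by
  obtain ⟨Q, hFQ⟩ := exists_pow_eq_expand_add (teichExp p)
  obtain ⟨c, M, N, hQ⟩ := exists_frobenius_quotient (by omega) hFQ map_teichExp
    coeff_teichExp_zero coeff_teichExp_one
  obtain ⟨a, ha⟩ := exists_eval₂_eq_one_add coeff_teichExp_zero coeff_teichExp_one ι (w ^ p)
  obtain ⟨r, hr⟩ := exists_add_pow_prime_eq hp.out 1 (w * (1 + ε))
  obtain ⟨g, hg⟩ : ∃ g, (1 + ε) ^ p = 1 + ε * g := by
    have h2 := sub_dvd_pow_sub_pow (1 + ε) 1 p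
    rw [one_pow, add_sub_cancel_left] at h2
    obtain ⟨k, hk⟩ := h2
    exact ⟨k, by linear_combination hk⟩
  rw [show 1 + w * (1 + ε) = z by rw [hz]; ring, mul_pow, hg, one_pow] at hr
  have hww : w ^ (p * (p - 1)) = w ^ p * w ^ (p * (p - 2)) := by
    rw [← pow_add]; congr 1
    obtain ⟨q, rfl⟩ : ∃ q, p = q + 2 := ⟨p - 2, by omega⟩
    rw [show q + 2 - 1 = q + 1 by omega, show q + 2 - 2 = q by omega]; ring
  have hwp : w ^ p = w * w ^ (p - 1) := by
    rw [← pow_succ', Nat.sub_add_cancel hp.out.one_le]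
  -- Here z^p = 1 + w^p(1 + εg) + p(...), so F(w^p) and z^p agree to first order in w^p; e is the
  -- quotient of their difference by w^p.
  obtain ⟨t, ht⟩ := eval₂_sub_pth_root_of_unity hp3 coeff_teichExp_zero coeff_teichExp_one hFQ hQ ι
    (ϖ := w ^ p) (ζ := z ^ p)
    (e := w * (w ^ (p - 1) * a + w ^ (p * (p - 2)) * (1 + ε) * r) + ε * (-g))
    (pow_ne_zero _ hw0) (fun h => hw ((isUnit_pow_iff hp.out.ne_zero).1 h))
    (by rw [hpw, ← pow_mul]) hz1
    (by
      rw [ha, hr, hpw, hww]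
      linear_combination w ^ p * a * hwp)
    (not_isUnit_add (not_isUnit_mul hw _) (not_isUnit_mul hε _))
  exact levelCongruence_of_pth_root hp3 map_teichExp hFQ hQ ι hw0 hw hpw ht

end InitialLevel

/-! ### The ring of integers of the algebraic closure. -/

section Integers

variable (p : ℕ) [hp : Fact p.Prime]

/-- The ring of integers of `PadicAlgCl p`. -/
abbrev AlgInt : ValuationSubring (PadicAlgCl p) :=
  (Valued.v : Valuation (PadicAlgCl p) ℝ≥0).valuationSubring

variable {p}

lemma mem_algInt_iff {x : PadicAlgCl p} : x ∈ AlgInt p ↔ ‖x‖ ≤ 1 := by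
  rw [Valuation.mem_valuationSubring_iff, PadicAlgCl.valuation_def, ← NNReal.coe_le_coe]
  simp

lemma isUnit_algInt_iff {x : AlgInt p} : IsUnit x ↔ ‖(x : PadicAlgCl p)‖ = 1 := by
  constructor
  · rintro ⟨u, rfl⟩
    have h1 := mem_algInt_iff.1 (u : AlgInt p).2
    have h2 := mem_algInt_iff.1 ((u⁻¹ : (AlgInt p)ˣ) : AlgInt p).2
    have h3 : ((u : AlgInt p) : PadicAlgCl p) *
        (((u⁻¹ : (AlgInt p)ˣ) : AlgInt p) : PadicAlgCl p) = 1 := by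
      exact congrArg (fun t : AlgInt p => (t : PadicAlgCl p)) u.mul_inv
    have h4 := congrArg norm h3
    rw [norm_mul, norm_one] at h4
    nlinarith [norm_nonneg ((u : AlgInt p) : PadicAlgCl p),
      norm_nonneg (((u⁻¹ : (AlgInt p)ˣ) : AlgInt p) : PadicAlgCl p)]
  · intro h
    have h0 : (x : PadicAlgCl p) ≠ 0 := by
      intro h0; rw [h0, norm_zero] at h; exact zero_ne_one h
    refine IsUnit.of_mul_eq_one ⟨(x : PadicAlgCl p)⁻¹, mem_algInt_iff.2 ?_⟩ ?_
    · rw [norm_inv, h, inv_one]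
    · exact Subtype.ext (mul_inv_cancel₀ h0)

lemma norm_eq_of_associated {x y : AlgInt p} (h : Associated x y) :
    ‖(x : PadicAlgCl p)‖ = ‖(y : PadicAlgCl p)‖ := by
  obtain ⟨u, rfl⟩ := h
  have := isUnit_algInt_iff.1 u.isUnit
  rw [MulMemClass.coe_mul, norm_mul, this, mul_one]

lemma not_isUnit_of_norm_lt_one {x : AlgInt p} (h : ‖(x : PadicAlgCl p)‖ < 1) : ¬ IsUnit x :=
  fun h1 => h.ne (isUnit_algInt_iff.1 h1)

variable (p) in
/-- The embedding of the `p`-adic integers in the field `PadicAlgCl p`. -/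
def padicIntCoe : ℤ_[p] →+* PadicAlgCl p :=
  (algebraMap ℚ_[p] (PadicAlgCl p)).comp PadicInt.Coe.ringHom

lemma padicIntCoe_apply (a : ℤ_[p]) :
    padicIntCoe p a = algebraMap ℚ_[p] (PadicAlgCl p) (a : ℚ_[p]) := rfl

variable (p) in
/-- The embedding of the `p`-adic integers in the integers of `PadicAlgCl p`. -/
def toAlgInt : ℤ_[p] →+* AlgInt p :=
  (padicIntCoe p).codRestrict (AlgInt p) fun a => mem_algInt_iff.2 <| by
    rw [padicIntCoe_apply, PadicAlgCl.norm_extends]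
    exact PadicInt.norm_le_one a

lemma coe_eval₂_toAlgInt (x : AlgInt p) (f : ℤ_[p][X]) :
    ((eval₂ (toAlgInt p) x f : AlgInt p) : PadicAlgCl p) =
      eval₂ (padicIntCoe p) (x : PadicAlgCl p) f :=
  hom_eval₂ f (toAlgInt p) (AlgInt p).subtype x

lemma eval₂_padicIntCoe_recPolyInt (β : ℕ) (x : PadicAlgCl p) :
    eval₂ (padicIntCoe p) x (recPolyInt p (β : ℤ_[p])) = aeval x (recPoly p (β : ℚ)) := by
  have h := congrArg (eval₂ (algebraMap ℚ_[p] (PadicAlgCl p)) x) (map_recPolyInt (p := p) β)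
  rw [eval₂_map, eval₂_map] at h
  rw [padicIntCoe, h, aeval_def]
  congr 1

lemma eval₂_padicIntCoe_teichExp (x : PadicAlgCl p) :
    eval₂ (padicIntCoe p) x (teichExp p) = ∑ k ∈ Finset.range p, (teich p (k !))⁻¹ * x ^ k := by
  rw [teichExp, eval₂_finsetSum]
  refine Finset.sum_congr rfl fun k hk => ?_
  rw [eval₂_mul, eval₂_C, eval₂_X_pow, padicIntCoe_apply,
    coe_inverse (isUnit_teichInt (not_dvd_factorial (Finset.mem_range.1 hk))), map_inv₀]
  rfl

end Integers

/-! ### Membership in the field, its degree, and uniformizers. -/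

section Fields

variable {p : ℕ} [hp : Fact p.Prime]

lemma norm_natCast_p : ‖(p : PadicAlgCl p)‖ = (p : ℝ)⁻¹ := by
  rw [← map_natCast (algebraMap ℚ_[p] (PadicAlgCl p)), PadicAlgCl.norm_extends, Padic.norm_p]

lemma norm_algEquiv {K : IntermediateField ℚ_[p] (PadicAlgCl p)}
    (σ : PadicAlgCl p ≃ₐ[K] PadicAlgCl p) (x : PadicAlgCl p) : ‖σ x‖ = ‖x‖ :=
  (spectralNorm_eq_of_equiv (K := ℚ_[p]) (L := PadicAlgCl p) (σ.restrictScalars ℚ_[p]) x).symm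

/-- The cofactor of a - b in a^{p-1} - b^{p-1} has residue p - 1 = -1, so it is nonzero. -/
lemma eq_of_pow_pred_eq {a b : PadicAlgCl p} (ha : ‖a - 1‖ < 1) (hb : ‖b - 1‖ < 1)
    (h : a ^ (p - 1) = b ^ (p - 1)) : a = b := by
  have hle : ∀ {c : PadicAlgCl p}, ‖c - 1‖ < 1 → c ∈ AlgInt p := fun {c} hc => by
    rw [show c = (c - 1) + 1 by ring]
    exact add_mem (mem_algInt_iff.2 hc.le) (one_mem _)
  set A : AlgInt p := ⟨a, hle ha⟩ with hA
  set B : AlgInt p := ⟨b, hle hb⟩ with hB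
  set π := IsLocalRing.residue (AlgInt p)
  have hres : ∀ {c : AlgInt p}, ‖((c - 1 : AlgInt p) : PadicAlgCl p)‖ < 1 → π c = 1 :=
    fun {c} hc => by
      have h1 : π (c - 1) = 0 :=
        (IsLocalRing.residue_eq_zero_iff _).2 (not_isUnit_of_norm_lt_one hc)
      rwa [map_sub, map_one, sub_eq_zero] at h1
  have hπA : π A = 1 := hres ha
  have hπB : π B = 1 := hres hb
  have hπp : (p : IsLocalRing.ResidueField (AlgInt p)) = 0 := by
    rw [← map_natCast π]
    refine (IsLocalRing.residue_eq_zero_iff _).2 (not_isUnit_of_norm_lt_one ?_)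
    change ‖(((p : AlgInt p)) : PadicAlgCl p)‖ < 1
    rw [show (((p : AlgInt p)) : PadicAlgCl p) = (p : PadicAlgCl p) by simp, norm_natCast_p]
    exact inv_lt_one_of_one_lt₀ (by exact_mod_cast hp.out.one_lt)
  have hAB : A ^ (p - 1) = B ^ (p - 1) := Subtype.ext h
  have hgeom := geom_sum₂_mul A B (p - 1)
  rw [hAB, sub_self] at hgeom
  have hsum : (∑ i ∈ Finset.range (p - 1), A ^ i * B ^ (p - 1 - 1 - i)) ≠ 0 := by
    intro h0
    have h1 := congrArg π h0
    rw [map_sum, map_zero] at h1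
    simp only [map_mul, map_pow, hπA, hπB, one_pow, mul_one, Finset.sum_const, Finset.card_range,
      nsmul_eq_mul] at h1
    rw [Nat.cast_sub hp.out.one_le, hπp] at h1
    simp at h1
  have hAB' : A = B := sub_eq_zero.1 ((mul_eq_zero.1 hgeom).resolve_left hsum)
  exact congrArg (fun t : AlgInt p => (t : PadicAlgCl p)) hAB'

/-- A `(p - 1)`-th root of an element of `K` close to an element of `K` lies in `K`. -/
lemma mem_of_pow_pred_mem {K : IntermediateField ℚ_[p] (PadicAlgCl p)} {w l : PadicAlgCl p}
    (hl : l ∈ K) (hw : w ^ (p - 1) ∈ K) (h : ‖l - w‖ < ‖l‖) : w ∈ K := by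
  have hl0 : l ≠ 0 := by
    rintro rfl; rw [norm_zero] at h; exact absurd h (not_lt.2 (norm_nonneg _))
  have hy1 : ‖w / l - 1‖ < 1 := by
    rw [div_sub_one hl0, norm_div, div_lt_one (norm_pos_iff.2 hl0), norm_sub_rev]
    exact h
  have hyp : (w / l) ^ (p - 1) ∈ K := by rw [div_pow]; exact div_mem hw (pow_mem hl _)
  -- A conjugate of w/l is equally close to 1 and has the same (p-1)-th power.
  have hfix : ∀ σ : PadicAlgCl p ≃ₐ[K] PadicAlgCl p, σ (w / l) = w / l := by
    intro σ
    refine eq_of_pow_pred_eq ?_ hy1 ?_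
    · rw [← map_one σ, ← map_sub, norm_algEquiv]
      exact hy1
    · rw [← map_pow]
      exact σ.commutes ⟨_, hyp⟩
  have hmem : w / l ∈ Set.range (algebraMap K (PadicAlgCl p)) :=
    (InfiniteGalois.mem_range_algebraMap_iff_fixed _).2 hfix
  obtain ⟨y, hy⟩ := hmem
  rw [← div_mul_cancel₀ w hl0, ← hy]
  exact mul_mem y.2 hl

/-- The norm is spectral: its power by the degree of x is the norm of the constant term of the
minimal polynomial, and that degree divides [K : ℚ_p]. -/
lemma exists_norm_pow_finrank {K : IntermediateField ℚ_[p] (PadicAlgCl p)}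
    [FiniteDimensional ℚ_[p] K] {x : PadicAlgCl p} (hx : x ∈ K) (hx0 : x ≠ 0) :
    ∃ j : ℤ, ‖x‖ ^ Module.finrank ℚ_[p] K = (p : ℝ) ^ (-j) := by
  have hint : IsIntegral ℚ_[p] x := Algebra.IsIntegral.isIntegral x
  have hdeg : (minpoly ℚ_[p] x).natDegree ∣ Module.finrank ℚ_[p] K := by
    have h1 := minpoly.degree_dvd (K := ℚ_[p]) (L := K) (x := (⟨x, hx⟩ : K))
      (Algebra.IsIntegral.isIntegral _)
    rwa [IntermediateField.minpoly_eq] at h1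
  obtain ⟨k, hk⟩ := hdeg
  have hnorm : ‖x‖ ^ (minpoly ℚ_[p] x).natDegree = ‖(minpoly ℚ_[p] x).coeff 0‖ := by
    rw [← PadicAlgCl.spectralNorm_eq, spectralNorm.spectralNorm_eq_norm_coeff_zero_rpow, ← Real.rpow_natCast,
      ← Real.rpow_mul (norm_nonneg _), one_div_mul_cancel, Real.rpow_one]
    exact_mod_cast (minpoly.natDegree_pos hint).ne'
  refine ⟨((minpoly ℚ_[p] x).coeff 0).valuation * k, ?_⟩
  rw [hk, pow_mul, hnorm, Padic.norm_eq_zpow_neg_valuation (minpoly.coeff_zero_ne_zero hint hx0),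
    ← neg_mul, zpow_mul, zpow_natCast]

/-- An element of norm `p ^ (-1 / N)` of an extension of degree at most `N` is a uniformizer. -/
lemma isUniformizer_of_norm_eq {K : IntermediateField ℚ_[p] (PadicAlgCl p)}
    [FiniteDimensional ℚ_[p] K] {N : ℕ} (hN : 0 < N) (hK : Module.finrank ℚ_[p] K ≤ N)
    {x : PadicAlgCl p} (hx : x ∈ K) (hnorm : ‖x‖ ^ N = (p : ℝ)⁻¹) : IsUniformizer p K x := by
  have hp1 : (1 : ℝ) < p := by exact_mod_cast hp.out.one_lt
  have hp0 : (0 : ℝ) < p := by linarith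
  have hx0 : x ≠ 0 := by
    rintro rfl
    rw [norm_zero, zero_pow hN.ne'] at hnorm
    exact (inv_pos.2 hp0).ne hnorm
  -- Comparing ‖x‖^{nN} computed in both ways gives N ∣ n, so the upper bound on the degree n is
  -- attained.
  have hfr : Module.finrank ℚ_[p] K = N := by
    obtain ⟨j, hj⟩ := exists_norm_pow_finrank hx hx0
    set n := Module.finrank ℚ_[p] K
    have h1 : (p : ℝ) ^ (-(n : ℤ)) = (p : ℝ) ^ (-j * N) := by
      rw [zpow_mul, ← hj, zpow_natCast, ← pow_mul, mul_comm, pow_mul, hnorm, zpow_neg, zpow_natCast,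
        inv_pow]
    have h2 := zpow_right_injective₀ hp0 hp1.ne' h1
    have h3 : (N : ℤ) ∣ n := ⟨j, by linarith⟩
    exact le_antisymm hK (Nat.le_of_dvd Module.finrank_pos (Int.natCast_dvd_natCast.1 h3))
  have hxlt : ‖x‖ < 1 := by
    by_contra h
    have h1 := one_le_pow₀ (not_lt.1 h) (n := N)
    rw [hnorm] at h1
    exact absurd h1 (not_le.2 (inv_lt_one_of_one_lt₀ hp1))
  have hmem : ∀ y : K, y ∈ valuationRing p K ↔ ‖(y : PadicAlgCl p)‖ ≤ 1 := fun y => mem_algInt_iff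
  refine ⟨⟨⟨x, hx⟩, (hmem _).2 hxlt.le⟩, rfl, ?_⟩
  set ϖ : valuationRing p K := ⟨⟨x, hx⟩, (hmem _).2 hxlt.le⟩ with hϖ
  have hunit : ∀ y : valuationRing p K, ‖((y : K) : PadicAlgCl p)‖ = 1 → IsUnit y := by
    intro y hy
    have hy0 : (y : K) ≠ 0 := by
      intro h0; rw [h0] at hy; simp at hy
    refine IsUnit.of_mul_eq_one ⟨(y : K)⁻¹, (hmem _).2 ?_⟩ (Subtype.ext (mul_inv_cancel₀ hy0))
    simp [hy]
  refine le_antisymm ?_ ?_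
  · intro y hy
    rw [Ideal.mem_span_singleton]
    rcases eq_or_ne ((y : K) : PadicAlgCl p) 0 with h0 | h0
    · have : y = 0 := Subtype.ext (Subtype.ext h0)
      rw [this]; exact dvd_zero _
    have hylt : ‖((y : K) : PadicAlgCl p)‖ < 1 :=
      lt_of_le_of_ne ((hmem _).1 y.2) fun h => hy (hunit y h)
    obtain ⟨j, hj⟩ := exists_norm_pow_finrank (y : K).2 h0
    rw [hfr] at hj
    have hj1 : (p : ℝ) ^ (-j) < (p : ℝ) ^ (0 : ℤ) := by
      rw [← hj, zpow_zero]
      exact pow_lt_one₀ (norm_nonneg _) hylt hN.ne'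
    have hj2 : -j ≤ -1 := by
      have := (zpow_lt_zpow_iff_right₀ hp1).1 hj1
      omega
    have hle : ‖((y : K) : PadicAlgCl p)‖ ≤ ‖x‖ := by
      refine le_of_pow_le_pow_left₀ hN.ne' (norm_nonneg _) ?_
      rw [hj, hnorm, ← zpow_neg_one]
      exact (zpow_le_zpow_iff_right₀ hp1).2 hj2
    have hxK0 : (⟨x, hx⟩ : K) ≠ 0 := fun h => hx0 (congrArg (fun t : K => (t : PadicAlgCl p)) h)
    refine ⟨⟨(y : K) / ⟨x, hx⟩, (hmem _).2 ?_⟩, Subtype.ext (mul_div_cancel₀ _ hxK0).symm⟩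
    rw [IntermediateField.coe_div, norm_div]
    exact div_le_one_of_le₀ hle (norm_nonneg _)
  · rw [Ideal.span_singleton_le_iff_mem]
    intro hu
    obtain ⟨b, hb⟩ := hu.exists_right_inv
    have h1 := congrArg (fun t : valuationRing p K => ‖((t : K) : PadicAlgCl p)‖) hb
    have h2 : ‖((b : K) : PadicAlgCl p)‖ ≤ 1 := (hmem _).1 b.2
    simp only [MulMemClass.coe_mul, norm_mul, OneMemClass.coe_one, norm_one] at h1
    have h3 : ‖((ϖ : K) : PadicAlgCl p)‖ = ‖x‖ := rfl
    rw [h3] at h1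
    nlinarith [norm_nonneg x, norm_nonneg ((b : K) : PadicAlgCl p)]

lemma finiteDimensional_field (z ρ : PadicAlgCl p) : FiniteDimensional ℚ_[p] (field p z ρ) :=
  IntermediateField.finiteDimensional_adjoin fun x _ => Algebra.IsIntegral.isIntegral x

/-- An upper bound suffices: linear disjointness of the two generating subfields need not be proved.
-/
lemma finrank_field_le {m : ℕ} (hm : 1 ≤ m) {z ρ : PadicAlgCl p} (hz : IsPrimitiveRoot z (p ^ m))
    (hρ : ρ ^ p = p) : Module.finrank ℚ_[p] (field p z ρ) ≤ p ^ m * (p - 1) := by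
  have hle : ∀ (y : PadicAlgCl p) (f : ℚ_[p][X]), f.Monic → aeval y f = 0 →
      Module.finrank ℚ_[p] (IntermediateField.adjoin ℚ_[p] {y}) ≤ f.natDegree := by
    intro y f hf hy
    rw [IntermediateField.adjoin.finrank (Algebra.IsIntegral.isIntegral y)]
    exact natDegree_le_of_dvd (minpoly.dvd _ _ hy) hf.ne_zero
  have h1 := hle z (cyclotomic (p ^ m) ℚ_[p]) (cyclotomic.monic _ _) (by
    rw [aeval_def, ← eval_map, map_cyclotomic]
    exact hz.isRoot_cyclotomic (pow_pos hp.out.pos m))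
  have h2 := hle ρ (X ^ p - C (p : ℚ_[p])) (monic_X_pow_sub_C _ hp.out.ne_zero) (by
    simp [hρ])
  rw [natDegree_cyclotomic, Nat.totient_prime_pow hp.out (by omega)] at h1
  rw [natDegree_X_pow_sub_C] at h2
  have h3 : field p z ρ = IntermediateField.adjoin ℚ_[p] {z} ⊔ IntermediateField.adjoin ℚ_[p] {ρ} := by
    rw [field, ← IntermediateField.adjoin_union]; rfl
  rw [h3]
  refine (IntermediateField.finrank_sup_le _ _).trans ((Nat.mul_le_mul h1 h2).trans (le_of_eq ?_))
  obtain ⟨k, rfl⟩ : ∃ k, m = k + 1 := ⟨m - 1, by omega⟩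
  rw [Nat.add_sub_cancel, pow_succ]; ring

end Fields

/-! ### The elements π^{m,1}: congruences, norms and fields. -/

section Main

variable {p : ℕ} [hp : Fact p.Prime]

lemma unif_three (ζ : ℕ → PadicAlgCl p) (ρ ω s : PadicAlgCl p) :
    unif p ζ ρ ω s 3 = (ζ 3 - 1) ^ (-2 * (p : ℤ) + 2) *
      (ζ 3 - aeval (unif p ζ ρ ω s 2) (R3 p)) := by
  simp only [unif]

lemma unif_add_four (ζ : ℕ → PadicAlgCl p) (ρ ω s : PadicAlgCl p) (m : ℕ) :
    unif p ζ ρ ω s (m + 4) = (ζ (m + 4) - 1) ^ (-2 * (p : ℤ) + 2) *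
      (ζ (m + 4) - aeval (unif p ζ ρ ω s (m + 3)) (R4 p)) := by
  rw [unif]

omit hp in
lemma R3_eq : R3 p = recPoly p ((1 : ℕ) : ℚ) := by rw [R3, Nat.cast_one]

omit hp in
lemma R4_eq : R4 p = recPoly p ((2 : ℕ) : ℚ) := by rw [R4, Nat.cast_ofNat]

lemma pow_pred_eq_neg (hp3 : 3 ≤ p) {ρ ω s : PadicAlgCl p}
    (hω : IsPrimitiveRoot ω (2 * (p - 1))) (hs : s ^ (p - 1) = ρ) : (ω * s) ^ (p - 1) = -ρ := by
  have h1 : IsPrimitiveRoot (ω ^ (p - 1)) 2 := hω.pow (by omega) (mul_comm _ _)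
  rw [mul_pow, hs, h1.eq_neg_one_of_two_right, neg_one_mul]

lemma natCast_eq_neg_pow (hp3 : 3 ≤ p) {ρ w : PadicAlgCl p} (hρ : ρ ^ p = p)
    (hw : w ^ (p - 1) = -ρ) : (p : PadicAlgCl p) = -w ^ (p * (p - 1)) := by
  have hodd : Odd p := hp.out.odd_of_ne_two (by omega)
  rw [mul_comm, pow_mul, hw, hodd.neg_pow, hρ, neg_neg]

lemma norm_sub_lt_right {z w : PadicAlgCl p} (h : ‖z - 1 - w‖ < ‖z - 1‖) : ‖z - 1 - w‖ < ‖w‖ := by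
  refine lt_of_lt_of_le h ?_
  have h1 := PadicAlgCl.isNonarchimedean p (z - 1 - w) w
  rw [sub_add_cancel] at h1
  rcases le_max_iff.1 h1 with h2 | h2
  · exact absurd h (not_lt.2 h2)
  · exact h2

lemma exists_levelCongruence_two (hp3 : 3 ≤ p) {ζ : ℕ → PadicAlgCl p} {ρ ω s : PadicAlgCl p}
    (hζ2 : (ζ 2 ^ p) ^ p = 1) (hρ : ρ ^ p = p) (hω : IsPrimitiveRoot ω (2 * (p - 1)))
    (hs : s ^ (p - 1) = ρ) (h_norm : ‖ζ 2 - 1 - ω * s‖ < ‖ζ 2 - 1‖) :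
    ∃ z x : AlgInt p, (z : PadicAlgCl p) = ζ 2 ∧ (x : PadicAlgCl p) = unif p ζ ρ ω s 2 ∧
      ‖(x : PadicAlgCl p)‖ ^ (p ^ 2 * (p - 1)) = (p : ℝ)⁻¹ ∧
      LevelCongruence (toAlgInt p) ((1 : ℕ) : ℤ_[p]) ((1 : ℕ) : ℤ_[p]) z x := by
  have hw := pow_pred_eq_neg hp3 hω hs
  have hpw := natCast_eq_neg_pow hp3 hρ hw
  have hlt := norm_sub_lt_right h_norm
  set w := ω * s with hwdef
  have hwn : ‖w‖ ^ (p * (p - 1)) = (p : ℝ)⁻¹ := by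
    rw [← norm_natCast_p, hpw, norm_neg, norm_pow]
  have hw0 : w ≠ 0 := norm_pos_iff.1 (lt_of_le_of_lt (norm_nonneg _) hlt)
  have hwlt : ‖w‖ < 1 := by
    by_contra h
    have h1 := one_le_pow₀ (not_lt.1 h) (n := p * (p - 1))
    rw [hwn] at h1
    exact absurd h1 (not_le.2 (inv_lt_one_of_one_lt₀ (by exact_mod_cast hp.out.one_lt)))
  have hε : ‖(ζ 2 - 1 - w) / w‖ < 1 := by
    rw [norm_div, div_lt_one (norm_pos_iff.2 hw0)]
    exact hlt
  set W : AlgInt p := ⟨w, mem_algInt_iff.2 hwlt.le⟩ with hW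
  set ε : AlgInt p := ⟨(ζ 2 - 1 - w) / w, mem_algInt_iff.2 hε.le⟩ with hεdef
  set z : AlgInt p := 1 + W + W * ε with hz
  have hzc : (z : PadicAlgCl p) = ζ 2 := by
    change 1 + w + w * ((ζ 2 - 1 - w) / w) = ζ 2
    rw [mul_div_cancel₀ _ hw0]; ring
  have hρ0 : ρ ≠ 0 := by
    rintro rfl
    rw [neg_zero] at hw
    exact pow_ne_zero _ hw0 hw
  obtain ⟨x, hx, hass, hL⟩ := levelCongruence_initial hp3 (toAlgInt p) (w := W) (z := z) (ε := ε)
    (fun h => hw0 (congrArg (fun t : AlgInt p => (t : PadicAlgCl p)) h))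
    (not_isUnit_of_norm_lt_one hwlt) (Subtype.ext (by simpa using hpw)) hz
    (not_isUnit_of_norm_lt_one hε) (Subtype.ext (by simpa [hzc] using hζ2))
  refine ⟨z, x, hzc, ?_, ?_, by simpa using hL⟩
  -- Since w^{p-1} = -ρ, the quotient (F(w) - z)/w^{p-1} is ρ⁻¹(z - F(w)).
  · have h1 := congrArg (fun t : AlgInt p => (t : PadicAlgCl p)) hx
    simp only [AddSubgroupClass.coe_sub, MulMemClass.coe_mul, SubmonoidClass.coe_pow,
      coe_eval₂_toAlgInt, hzc, eval₂_padicIntCoe_teichExp] at h1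
    change ∑ k ∈ Finset.range p, (teich p (k !))⁻¹ * w ^ k - ζ 2 = w ^ (p - 1) * x at h1
    rw [hw] at h1
    rw [unif, eq_inv_mul_iff_mul_eq₀ hρ0]
    have h2 : ∑ k ∈ Finset.range p, (teich p (k !))⁻¹ * ω ^ k * s ^ k =
        ∑ k ∈ Finset.range p, (teich p (k !))⁻¹ * w ^ k :=
      Finset.sum_congr rfl fun k _ => by rw [hwdef, mul_pow, mul_assoc]
    rw [h2]
    linear_combination h1
  · have h1 := norm_eq_of_associated hass
    rw [SubmonoidClass.coe_pow, norm_pow] at h1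
    rw [pow_two, mul_assoc, pow_mul, h1]
    exact hwn

/-- Natural β and c let the integral polynomial be matched with the rational `recPoly` in the
definition of `unif`. -/
lemma exists_levelCongruence_succ (hp3 : 3 ≤ p) {β c m : ℕ} {ζ' : PadicAlgCl p} {z x : AlgInt p}
    (hζ' : ζ' ^ p = z)
    (hnorm : ‖(x : PadicAlgCl p)‖ ^ (p ^ m * (p - 1)) = (p : ℝ)⁻¹)
    (hL : LevelCongruence (toAlgInt p) (β : ℤ_[p]) (c : ℤ_[p]) z x) :
    ∃ z' u : AlgInt p, (z' : PadicAlgCl p) = ζ' ∧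
      (u : PadicAlgCl p) = (ζ' - 1) ^ (-2 * (p : ℤ) + 2) *
        (ζ' - aeval (x : PadicAlgCl p) (recPoly p (β : ℚ))) ∧
      ‖(u : PadicAlgCl p)‖ ^ (p ^ (m + 1) * (p - 1)) = (p : ℝ)⁻¹ ∧
      LevelCongruence (toAlgInt p) ((β + c : ℕ) : ℤ_[p]) ((0 : ℕ) : ℤ_[p]) z' u := by
  have hmem : ζ' ∈ AlgInt p := by
    rw [mem_algInt_iff]
    by_contra h
    have h1 := one_lt_pow₀ (not_le.1 h) hp.out.ne_zero
    rw [← norm_pow, hζ'] at h1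
    exact absurd (mem_algInt_iff.1 z.2) (not_le.2 h1)
  obtain ⟨u, hu, h0, hass, hL'⟩ := hL.step (z' := ⟨ζ', hmem⟩) hp3 (Subtype.ext hζ')
  refine ⟨⟨ζ', hmem⟩, u, rfl, ?_, ?_, by push_cast; exact hL'⟩
  · have h1 := congrArg (fun t : AlgInt p => (t : PadicAlgCl p)) hu
    simp only [AddSubgroupClass.coe_sub, MulMemClass.coe_mul, SubmonoidClass.coe_pow,
      coe_eval₂_toAlgInt, OneMemClass.coe_one, eval₂_padicIntCoe_recPolyInt] at h1
    have h0' : ζ' - 1 ≠ 0 := fun h => h0 (Subtype.ext h)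
    have hexp : -2 * (p : ℤ) + 2 = -((2 * p - 2 : ℕ) : ℤ) := by omega
    rw [h1, hexp, zpow_neg, zpow_natCast, inv_mul_cancel_left₀ (pow_ne_zero _ h0')]
  · have h1 := norm_eq_of_associated hass
    rw [SubmonoidClass.coe_pow, norm_pow] at h1
    rw [pow_succ', mul_assoc, pow_mul, h1, hnorm]

lemma exists_levelCongruence (hp3 : 3 ≤ p) {ζ : ℕ → PadicAlgCl p} {ρ ω s : PadicAlgCl p}
    (hζ0 : ζ 0 = 1) (hζ : ∀ m, ζ (m + 1) ^ p = ζ m) (hρ : ρ ^ p = p)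
    (hω : IsPrimitiveRoot ω (2 * (p - 1))) (hs : s ^ (p - 1) = ρ)
    (h_norm : ‖ζ 2 - 1 - ω * s‖ < ‖ζ 2 - 1‖) (m : ℕ) :
    ∃ z x : AlgInt p, (z : PadicAlgCl p) = ζ (m + 3) ∧
      (x : PadicAlgCl p) = unif p ζ ρ ω s (m + 3) ∧
      ‖(x : PadicAlgCl p)‖ ^ (p ^ (m + 3) * (p - 1)) = (p : ℝ)⁻¹ ∧
      LevelCongruence (toAlgInt p) ((2 : ℕ) : ℤ_[p]) ((0 : ℕ) : ℤ_[p]) z x := by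
  induction m with
  | zero =>
    obtain ⟨z, x, hz, hx, hn, hL⟩ := exists_levelCongruence_two hp3
      (by rw [hζ 1, hζ 0, hζ0]) hρ hω hs h_norm
    obtain ⟨z', u, hz', hu, hn', hL'⟩ := exists_levelCongruence_succ hp3 (ζ' := ζ 3)
      (by rw [hz]; exact hζ 2) hn hL
    refine ⟨z', u, hz', ?_, hn', hL'⟩
    rw [hu, hx, ← R3_eq, show 0 + 3 = 3 by rfl, unif_three]
  | succ m ih =>
    obtain ⟨z, x, hz, hx, hn, hL⟩ := ih
    obtain ⟨z', u, hz', hu, hn', hL'⟩ := exists_levelCongruence_succ hp3 (ζ' := ζ (m + 4))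
      (by rw [hz]; exact hζ (m + 3)) hn hL
    refine ⟨z', u, hz', ?_, hn', hL'⟩
    rw [hu, hx, ← R4_eq, show m + 1 + 3 = m + 4 by ring, unif_add_four]

lemma aeval_mem_of_mem {K : IntermediateField ℚ_[p] (PadicAlgCl p)} {x : PadicAlgCl p}
    (hx : x ∈ K) (f : ℚ[X]) : aeval x f ∈ K := by
  rw [aeval_eq_sum_range]
  exact sum_mem fun i _ => SubfieldClass.qsmul_mem K _ (pow_mem hx i)

lemma unif_mem_field (hp3 : 3 ≤ p) {ζ : ℕ → PadicAlgCl p} {ρ ω s : PadicAlgCl p}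
    (hζ : ∀ m, ζ (m + 1) ^ p = ζ m) (hω : IsPrimitiveRoot ω (2 * (p - 1)))
    (hs : s ^ (p - 1) = ρ) (h_norm : ‖ζ 2 - 1 - ω * s‖ < ‖ζ 2 - 1‖) (m : ℕ) :
    unif p ζ ρ ω s (m + 2) ∈ field p (ζ (m + 2)) ρ := by
  have hz : ∀ n, ζ n ∈ field p (ζ n) ρ := fun n =>
    IntermediateField.subset_adjoin _ _ (Set.mem_insert _ _)
  have hρK : ∀ n, ρ ∈ field p (ζ n) ρ := fun n =>
    IntermediateField.subset_adjoin _ _ (Set.mem_insert_of_mem _ rfl)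
  have hle : ∀ n, field p (ζ n) ρ ≤ field p (ζ (n + 1)) ρ := by
    intro n
    refine IntermediateField.adjoin_le_iff.2 ?_
    rintro y (rfl | hy)
    · change ζ n ∈ field p (ζ (n + 1)) ρ
      rw [← hζ n]; exact pow_mem (hz _) p
    · rw [Set.mem_singleton_iff.1 hy]; exact hρK _
  induction m with
  | zero =>
    -- The sum defining π^{2,1} depends on ω and s only through ωs, which is close to ζ_{p²} - 1 and
    -- has (p-1)-th power -ρ.
    have hw : ω * s ∈ field p (ζ 2) ρ := by
      refine mem_of_pow_pred_mem (sub_mem (hz 2) (one_mem _)) ?_ h_norm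
      rw [pow_pred_eq_neg hp3 hω hs]
      exact neg_mem (hρK 2)
    rw [unif]
    refine mul_mem (inv_mem (hρK 2)) (sub_mem (hz 2) (sum_mem fun k _ => ?_))
    rw [mul_assoc, ← mul_pow]
    exact mul_mem (inv_mem (IntermediateField.algebraMap_mem _ _)) (pow_mem hw k)
  | succ m ih =>
    have h1 := hle _ ih
    have h2 := hz (m + 3)
    have h3 : ∀ f : ℚ[X], (ζ (m + 3) - 1) ^ (-2 * (p : ℤ) + 2) *
        (ζ (m + 3) - aeval (unif p ζ ρ ω s (m + 2)) f) ∈ field p (ζ (m + 3)) ρ := fun f =>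
      mul_mem (zpow_mem (sub_mem h2 (one_mem _)) _) (sub_mem h2 (aeval_mem_of_mem h1 f))
    cases m with
    | zero => rw [show 0 + 1 + 2 = 3 by rfl, unif_three]; exact h3 _
    | succ m => rw [show m + 1 + 1 + 2 = m + 4 by ring, unif_add_four]; exact h3 _

end Main

end FalseTate

end

theorem theorem1p1 (p : ℕ) [Fact p.Prime] (hp : 3 ≤ p)
    (ζ : ℕ → PadicAlgCl p)
    (hζ : ∀ m, IsPrimitiveRoot (ζ m) (p ^ m))
    (hζ_compat : ∀ m, ζ (m + 1) ^ p = ζ m)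
    (ρ ω s : PadicAlgCl p)
    (hρ : ρ ^ p = (p : PadicAlgCl p))
    (hω : IsPrimitiveRoot ω (2 * (p - 1)))
    (hs : s ^ (p - 1) = ρ)
    (h_norm : ‖ζ 2 - 1 - ω * s‖ < ‖ζ 2 - 1‖) :
    (∀ k, ¬ p ∣ ((FalseTate.R3 p).coeff k).den) ∧
    (∀ k, ¬ p ∣ ((FalseTate.R4 p).coeff k).den) ∧
    ∀ m, 3 ≤ m →
      FalseTate.IsUniformizer p (FalseTate.field p (ζ m) ρ) (FalseTate.unif p ζ ρ ω s m) ∧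
      ‖FalseTate.unif p ζ ρ ω s m‖ = (p : ℝ) ^ (-(1 / ((p : ℝ) ^ m * ((p : ℝ) - 1)))) := by
  refine ⟨fun k => ?_, fun k => ?_, fun m hm => ?_⟩
  · rw [FalseTate.R3_eq]; exact FalseTate.not_dvd_den_coeff_recPoly 1 k
  · rw [FalseTate.R4_eq]; exact FalseTate.not_dvd_den_coeff_recPoly 2 k
  · have hζ0 : ζ 0 = 1 := by simpa using hζ 0
    obtain ⟨n, rfl⟩ : ∃ n, m = n + 3 := ⟨m - 3, by omega⟩
    obtain ⟨z, x, -, hx, hn, -⟩ :=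
      FalseTate.exists_levelCongruence hp hζ0 hζ_compat hρ hω hs h_norm n
    rw [hx] at hn
    have hN : 0 < p ^ (n + 3) * (p - 1) :=
      Nat.mul_pos (pow_pos (by omega) _) (by omega)
    have := FalseTate.finiteDimensional_field (ζ (n + 3)) ρ
    refine ⟨FalseTate.isUniformizer_of_norm_eq hN
      (FalseTate.finrank_field_le (by omega) (hζ _) hρ)
      (FalseTate.unif_mem_field hp hζ_compat hω hs h_norm (n + 1)) hn, ?_⟩
    have hp0 : (0 : ℝ) ≤ p := Nat.cast_nonneg p
    have hcast : ((p ^ (n + 3) * (p - 1) : ℕ) : ℝ) = (p : ℝ) ^ (n + 3) * ((p : ℝ) - 1) := by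
      rw [Nat.cast_mul, Nat.cast_pow, Nat.cast_sub (by omega), Nat.cast_one]
    rw [← hcast, Real.rpow_neg hp0, ← Real.inv_rpow hp0, ← hn, one_div,
      Real.pow_rpow_inv_natCast (norm_nonneg _) hN.ne']
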